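/- Let $\mathcal H_1,\mathcal H_2$ be separable complex Hilbert spaces. Products of (unbounded) linear operators are maximally defined, i.e. $\operatorname{dom}(AB)=\{f\in\operatorname{dom}(B)\mid Bf\in\operatorname{dom}(A)\}$. For $p\in[1,\infty)$, $\mathcal B_p$ denotes the Schatten class of compact operators whose singular values (counted with multiplicity) lie in $\ell^p$, with norm the $\ell^p$-norm of the singular values. For $\omega\in(0,\pi)$ put $S_\omega=\{z\in\mathbb C\mid z\neq0,\ |\arg z|<\omega\}$, and put $S_0=(0,\infty)$. A densely defined closed operator $T$ in a Hilbert space $\mathcal H$ is called *sectorial* if, for some $\omega\in[0,\pi)$, $\sigma(T)\subseteq\overline{S_\omega}$ and $\sup_{z\in\mathbb C\setminus\overline{S_{\omega'}}}\|z(T-zI)^{-1}\|<\infty$ for all $\omega'\in(\omega,\pi)$. If $T$ is sectorial and $T^{-1}\in\mathcal B(\mathcal H)$, then for $\operatorname{Re}z>0$ one defines $$T^{-z}=\frac1{2\pi i}\int_\Gamma \zeta^{-z}(T-\zeta I)^{-1}\,d\zeta\in\mathcal B(\mathcal H)$$ with the principal branch of $\zeta^{-z}$, where $\Gamma\subset(\mathbb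 C\setminus(-\infty,0])\cap\rho(T)$ runs from $\infty e^{-i\varphi}$ to $\delta e^{-i\varphi}$ along a ray, to $\delta e^{i\varphi}$ along the arc $\{\delta e^{it}\mid |t|\le\varphi\}$, and to $\infty e^{i\varphi}$ along a ray; here $\varphi\in(\omega,\pi)$, and $\delta>0$ is such that $\{|\zeta|\le\delta\}\subset\rho(T)$. For $s\in\mathbb R$, $T^{is}f=\lim_{w\to-is,\ \operatorname{Re}w>0}T^{-w}f$, with domain the set of all $f\in\mathcal H$ for which this limit exists. For $N\ge1$ and $\theta\ge0$ one writes $T\in\mathrm{BIP}(N,\theta)$ if, for all $s\in\mathbb R$, $T^{is}\in\mathcal B(\mathcal H)$ and $\|T^{is}\|\le Ne^{\theta|s|}$. **Corollary 4.8.** Let $T_j$ be sectorial operators in $\mathcal H_j$ with $T_j^{-1}\in\mathcal B(\mathcal H_j)$ and $T_j\in\mathrm{BIP}(N_j,\theta_j)$, where $N_j\ge1$ and $\theta_j\ge0$, $j=1,2$. Let $S$ be a closed operator from $\operatorname{dom}(S)\subseteq\mathcal H_1$ into $\mathcal H_2$ with $\operatorname{dom}(S)\supseteq\operatorname{dom}(T_1)$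 and $\operatorname{dom}(S^*)\supseteq\operatorname{dom}(T_2^*)$. Let $p\in[1,\infty)$ and assume that $$ST_1^{-1}\in\mathcal B_p(\mathcal H_1,\mathcal H_2),\qquad S^*(T_2^*)^{-1}\in\mathcal B_p(\mathcal H_2,\mathcal H_1).$$ Then for every $z\in\mathbb C$ with $0\le\operatorname{Re}z\le1$ the operator $T_2^{-z}ST_1^{-1+z}$ is well defined on $\operatorname{dom}(T_1)$, it is closable as an operator with that domain, and its closure satisfies $\overline{T_2^{-z}ST_1^{-1+z}}\in\mathcal B_p(\mathcal H_1,\mathcal H_2)$. Moreover, for every $k\in(0,\infty)$ and every such $z$, $$\big\|\overline{T_2^{-z}ST_1^{-1+z}}\big\|_{\mathcal B_p(\mathcal H_1,\mathcal H_2)}\le N_1N_2\,e^{k(\operatorname{Im}z)^2+k\operatorname{Re}(z)[1-\operatorname{Re}(z)]+(4k)^{-1}(\theta_1+\theta_2)^2}\,\big\|ST_1^{-1}\big\|_{\mathcal B_p(\mathcal H_1,\mathcal H_2)}^{1-\operatorname{Re}z}\,\big\|S^*(T_2^*)^{-1}\big\|_{\mathcal B_p(\mathcal H_2,\mathcal H_1)}^{\operatorname{Re}z},$$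 and for every $x\in[0,1]$, $$\big\|\overline{T_2^{-x}ST_1^{-1+x}}\big\|_{\mathcal B_p(\mathcal H_1,\mathcal H_2)}\le N_1N_2\,e^{(\theta_1+\theta_2)[x(1-x)]^{1/2}}\,\big\|ST_1^{-1}\big\|_{\mathcal B_p(\mathcal H_1,\mathcal H_2)}^{1-x}\,\big\|S^*(T_2^*)^{-1}\big\|_{\mathcal B_p(\mathcal H_2,\mathcal H_1)}^{x}$$ (with the convention $0^0=1$). -/

import Mathlib

open MeasureTheory Filter Topology
open scoped LinearPMap

noncomputable section

namespace SectorialInterpolation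

variable {E F G H : Type*}
  [NormedAddCommGroup E] [InnerProductSpace ℂ E]
  [NormedAddCommGroup F] [InnerProductSpace ℂ F]
  [NormedAddCommGroup G] [InnerProductSpace ℂ G]
  [NormedAddCommGroup H] [InnerProductSpace ℂ H]

/-! ### Unbounded operators: products, bounded operators, resolvents -/

/-- A bounded operator, regarded as an everywhere defined linear operator. -/
def ofBounded (B : E →L[ℂ] F) : E →ₗ.[ℂ] F :=
  (B : E →ₗ[ℂ] F).toPMap ⊤

/-- The maximal domain `{x ∈ dom B | B x ∈ dom A}` of the operator product `A B`. -/
def opProdDomain (A : F →ₗ.[ℂ] G) (B : E →ₗ.[ℂ] F) : Submodule ℂ E :=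
  (A.domain.comap B.toFun).map B.domain.subtype

theorem opProdDomain_le (A : F →ₗ.[ℂ] G) (B : E →ₗ.[ℂ] F) :
    opProdDomain A B ≤ B.domain := by
  rintro x ⟨y, -, rfl⟩
  exact y.2

theorem mem_domain_of_mem_opProdDomain (A : F →ₗ.[ℂ] G) (B : E →ₗ.[ℂ] F)
    (x : opProdDomain A B) :
    B.toFun (Submodule.inclusion (opProdDomain_le A B) x) ∈ A.domain := by
  obtain ⟨x, y, hy, rfl⟩ := x
  exact hy

/-- The operator product `A B`, maximally defined. -/
def opProd (A : F →ₗ.[ℂ] G) (B : E →ₗ.[ℂ] F) : E →ₗ.[ℂ] G where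
  domain := opProdDomain A B
  toFun := A.toFun ∘ₗ
    (B.toFun ∘ₗ Submodule.inclusion (opProdDomain_le A B)).codRestrict A.domain
      (mem_domain_of_mem_opProdDomain A B)

/-- `R` is the bounded, everywhere defined inverse of `T - z I`. -/
def IsResolventAt (T : H →ₗ.[ℂ] H) (z : ℂ) (R : H →L[ℂ] H) : Prop :=
  (∀ x : T.domain, R (T x - z • (x : H)) = x) ∧
    ∀ y : H, ∃ h : R y ∈ T.domain, T ⟨R y, h⟩ - z • R y = y

/-- The resolvent set `ρ(T)`. -/
def resSet (T : H →ₗ.[ℂ] H) : Set ℂ :=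
  {z | ∃ R : H →L[ℂ] H, IsResolventAt T z R}

open Classical in
/-- `(T - z I)⁻¹` for `z ∈ ρ(T)`; it is set to `0` off the resolvent set. -/
def resolvent (T : H →ₗ.[ℂ] H) (z : ℂ) : H →L[ℂ] H :=
  if h : z ∈ resSet T then h.choose else 0

/-! ### Sectorial operators -/

open Classical in
/-- The open sector `S_ω`; for `ω = 0` it is the half-line `(0, ∞)`. -/
def sector (ω : ℝ) : Set ℂ :=
  if ω = 0 then {z | 0 < z.re ∧ z.im = 0} else {z | z ≠ 0 ∧ |z.arg| < ω}

/-- `T ∈ Sect(ω)`. The spectrum is the complement of the resolvent set. -/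
structure IsSectorialOfAngle (T : H →ₗ.[ℂ] H) (ω : ℝ) : Prop where
  dense_domain : Dense (T.domain : Set H)
  isClosed : T.IsClosed
  angle_nonneg : 0 ≤ ω
  angle_lt_pi : ω < Real.pi
  spectrum_subset : (resSet T)ᶜ ⊆ closure (sector ω)
  resolvent_bound : ∀ ω' : ℝ, ω < ω' → ω' < Real.pi →
    ∃ C : ℝ, ∀ z : ℂ, z ∉ closure (sector ω') → ‖z • resolvent T z‖ ≤ C

/-- `T` is sectorial of some angle in `[0, π)`. -/
def IsSectorial (T : H →ₗ.[ℂ] H) : Prop :=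
  ∃ ω : ℝ, IsSectorialOfAngle T ω

/-! ### Complex powers -/

/-- The contour made of the two rays `{r e^{± i φ} | r ≥ δ}` and the arc
`{δ e^{i t} | |t| ≤ φ}` surrounds the spectrum of `T` inside
`(ℂ \ (-∞, 0]) ∩ ρ(T)`. -/
structure IsAdmissibleContour (T : H →ₗ.[ℂ] H) (φ δ : ℝ) : Prop where
  angle : ∃ ω : ℝ, ω < φ ∧ IsSectorialOfAngle T ω
  angle_lt_pi : φ < Real.pi
  radius_pos : 0 < δ
  ball_subset : Metric.closedBall (0 : ℂ) δ ⊆ resSet T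

/-- The Dunford integral `(2πi)⁻¹ ∮ ζ^{-z} (T - ζ I)⁻¹ dζ` over the contour with parameters
`φ, δ`, run through from `∞ e^{-iφ}` to `δ e^{-iφ}`, along the arc to `δ e^{iφ}`, and on to
`∞ e^{iφ}` (clockwise around the spectrum). -/
def dunfordIntegral (T : H →ₗ.[ℂ] H) (φ δ : ℝ) (z : ℂ) : H →L[ℂ] H :=
  let f : ℂ → (H →L[ℂ] H) := fun ζ => ζ ^ (-z) • resolvent T ζ
  let u : ℝ → ℂ := fun t => Complex.exp (t * Complex.I)
  (2 * Real.pi * Complex.I)⁻¹ •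
    (-(∫ r in Set.Ioi δ, u (-φ) • f (r * u (-φ)))
      + (∫ t in (-φ)..φ, (Complex.I * δ * u t) • f (δ * u t))
      + ∫ r in Set.Ioi δ, u φ • f (r * u φ))

open Classical in
/-- `T^{-z} ∈ B(H)` for `Re z > 0`: the Dunford integral over an admissible contour
(its value does not depend on the contour). -/
def dunfordPow (T : H →ₗ.[ℂ] H) (z : ℂ) : H →L[ℂ] H :=
  if h : ∃ c : ℝ × ℝ, IsAdmissibleContour T c.1 c.2 then
    dunfordIntegral T h.choose.1 h.choose.2 z
  else 0

/-- The filter `w → -is, Re w > 0`. -/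
def approach (s : ℝ) : Filter ℂ :=
  𝓝[{w : ℂ | 0 < w.re}] (-(Complex.I * s))

instance approach_neBot (s : ℝ) : (approach s).NeBot := by
  rw [approach, ← mem_closure_iff_nhdsWithin_neBot, Complex.closure_setOfPred_lt_re]
  simp

/-- The domain of `T^{is}`: the vectors `f` for which `T^{-w} f` converges as
`w → -is`, `Re w > 0`. -/
def imagPowDomain (T : H →ₗ.[ℂ] H) (s : ℝ) : Submodule ℂ H where
  carrier := {f | ∃ g : H, Tendsto (fun w => dunfordPow T w f) (approach s) (𝓝 g)}
  zero_mem' := ⟨0, by simp⟩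
  add_mem' := by
    rintro a b ⟨a', ha⟩ ⟨b', hb⟩
    exact ⟨a' + b', by simpa using ha.add hb⟩
  smul_mem' := by
    rintro c a ⟨a', ha⟩
    exact ⟨c • a', by simpa using ha.const_smul c⟩

/-- The imaginary power `T^{is}`, the strong limit of `T^{-w}` as `w → -is`, `Re w > 0`,
on the set of vectors where this limit exists. -/
def imagPow (T : H →ₗ.[ℂ] H) (s : ℝ) : H →ₗ.[ℂ] H where
  domain := imagPowDomain T s
  toFun :=
    { toFun := fun f => f.2.choose
      map_add' := fun a b => by
        refine tendsto_nhds_unique (a + b).2.choose_spec ?_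
        simpa using a.2.choose_spec.add b.2.choose_spec
      map_smul' := fun c a => by
        refine tendsto_nhds_unique (c • a).2.choose_spec ?_
        simpa using a.2.choose_spec.const_smul c }

open Classical in
/-- `T^{-z}` for `Re z ≥ 0`: the Dunford integral if `Re z > 0`, and the imaginary power
`T^{is}` with `is = -z` if `Re z = 0`. -/
def negPow (T : H →ₗ.[ℂ] H) (z : ℂ) : H →ₗ.[ℂ] H :=
  if 0 < z.re then ofBounded (dunfordPow T z) else imagPow T (-z.im)

/-- The maximally defined product `T₂^{-z} S T₁^{-1+z}`, for `0 ≤ Re z ≤ 1`. -/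
def sandwich (T₁ : E →ₗ.[ℂ] E) (T₂ : F →ₗ.[ℂ] F) (S : E →ₗ.[ℂ] F) (z : ℂ) : E →ₗ.[ℂ] F :=
  opProd (negPow T₂ z) (opProd S (negPow T₁ (1 - z)))

/-- The bound in `T ∈ BIP(N, θ)`: every `T^{is}` is a bounded, everywhere defined operator of
norm at most `N e^{θ|s|}`. -/
structure HasBIP (T : H →ₗ.[ℂ] H) (N θ : ℝ) : Prop where
  one_le : 1 ≤ N
  nonneg : 0 ≤ θ
  bounded : ∀ s : ℝ, ∃ B : H →L[ℂ] H,
    imagPow T s = ofBounded B ∧ ‖B‖ ≤ N * Real.exp (θ * |s|)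

/-! ### Schatten classes -/

/-- The multiplicity of `t > 0` as a singular value of `A`, that is, of `t²` as an eigenvalue
of `A* A`. -/
def singularMultiplicity [CompleteSpace E] [CompleteSpace F] (A : E →L[ℂ] F) (t : ℝ) : ℕ :=
  Module.finrank ℂ
    (Module.End.eigenspace
      ((ContinuousLinearMap.adjoint A ∘L A : E →L[ℂ] E) : E →ₗ[ℂ] E) ((t ^ 2 : ℝ) : ℂ))

/-- `A ∈ B_p(E, F)`: `A` is compact and its singular values, counted with multiplicity, are
`p`-summable. -/
def MemSchatten [CompleteSpace E] [CompleteSpace F] (p : ℝ) (A : E →L[ℂ] F) : Prop :=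
  IsCompactOperator A ∧
    Summable fun t : Set.Ioi (0 : ℝ) => (singularMultiplicity A t : ℝ) * (t : ℝ) ^ p

/-- The norm of `B_p(E, F)`: the `ℓ^p`-norm of the singular values. -/
def schattenNorm [CompleteSpace E] [CompleteSpace F] (p : ℝ) (A : E →L[ℂ] F) : ℝ :=
  (∑' t : Set.Ioi (0 : ℝ), (singularMultiplicity A t : ℝ) * (t : ℝ) ^ p) ^ (1 / p)

end SectorialInterpolation

end

open SectorialInterpolation

/-! Under the `BIP(N, θ)` bounds the powers `T⁻ᶻ` given by the Dunford integral are analytic in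
`Re z > 0`, extend strongly continuously to `Re z = 0`, and grow at most exponentially along
vertical strips. Put `Q_j = T_j⁻¹`. On `dom T₁` the operator `B z = T₂⁻ᶻ S T₁^{z-1}` satisfies
`B z Q₁ = T₂⁻ᶻ A₁ T₁^{z-1}`, and duality gives `Q₂ A₁ = A₂* Q₁`. Up to the regularising factors in
`Q₂ (B z) Q₁²`, it is therefore `A₁` on the edge `Re z = 0` and `A₂*` on the edge `Re z = 1`,
multiplied on both sides by imaginary powers.

A Schatten norm is the supremum of the `ℓ^p` norms of `(⟨y_i, A x_i⟩)_i` over finite orthonormal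
systems. Pairing the regularised family with finite systems of vectors reduces the interpolation to
the three lines theorem for `ℓ^p`-valued functions, where the factor `e^{k z (z - 1)}` compensates
the growth `e^{(θ₁ + θ₂) |Im z|}` on the edges. The regularisation is removed because the ranges of
`Q₁` and `Q₂*` are dense, and the square root in the second estimate is the optimum over `k`.
-/

noncomputable section

namespace SectorialInterpolation

/-! ### Resolvents -/

section Resolvent

variable {H : Type*} [NormedAddCommGroup H] [InnerProductSpace ℂ H]
  {T : H →ₗ.[ℂ] H} {z w : ℂ} {R Q : H →L[ℂ] H}

theorem IsResolventAt.unique (hR : IsResolventAt T z R) (hQ : IsResolventAt T z Q) : R = Q := by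
  ext y
  obtain ⟨hmem, hRy⟩ := hR.2 y
  simpa only [hRy] using (hQ.1 ⟨R y, hmem⟩).symm

theorem isResolventAt_resolvent (h : z ∈ resSet T) : IsResolventAt T z (resolvent T z) := by
  rw [resolvent, dif_pos h]
  exact h.choose_spec

theorem IsResolventAt.resolvent_eq (hR : IsResolventAt T z R) : resolvent T z = R :=
  (isResolventAt_resolvent ⟨R, hR⟩).unique hR

theorem IsResolventAt.sub_eq_smul_mul (hR : IsResolventAt T z R) (hQ : IsResolventAt T w Q) :
    R - Q = (z - w) • (R * Q) := by
  ext y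
  obtain ⟨hmem, hQy⟩ := hQ.2 y
  have hy : y = (T ⟨Q y, hmem⟩ - z • Q y) + (z - w) • Q y :=
    calc y = T ⟨Q y, hmem⟩ - w • Q y := hQy.symm
      _ = _ := by module
  have hRy : R y = Q y + (z - w) • R (Q y) :=
    calc R y = R ((T ⟨Q y, hmem⟩ - z • Q y) + (z - w) • Q y) := congrArg R hy
      _ = Q y + (z - w) • R (Q y) := by rw [map_add, map_smul, hR.1 ⟨Q y, hmem⟩]
  simp [hRy]

theorem IsResolventAt.inverse_mul (hR : IsResolventAt T z R) (hQ : IsResolventAt T 0 Q)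
    (hz : z ≠ 0) : Q * R = z⁻¹ • (R - Q) := by
  rw [← neg_sub, hQ.sub_eq_smul_mul hR, zero_sub, neg_smul, neg_neg, inv_smul_smul₀ hz]

theorem IsResolventAt.mul_inverse (hR : IsResolventAt T z R) (hQ : IsResolventAt T 0 Q)
    (hz : z ≠ 0) : R * Q = z⁻¹ • (R - Q) := by
  rw [hR.sub_eq_smul_mul hQ, sub_zero, inv_smul_smul₀ hz]

theorem eventually_norm_sub_smul_lt_one (w : ℂ) (Q : H →L[ℂ] H) :
    ∀ᶠ z in 𝓝 w, ‖(z - w) • Q‖ < 1 := by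
  have hcont : Continuous fun z : ℂ => ‖(z - w) • Q‖ := by fun_prop
  exact hcont.continuousAt.eventually_lt continuousAt_const (by simp)

variable [CompleteSpace H]

theorem IsResolventAt.isResolventAt_of_norm_lt (hQ : IsResolventAt T w Q)
    (h : ‖(z - w) • Q‖ < 1) :
    IsResolventAt T z (Q * Ring.inverse (1 - (z - w) • Q)) := by
  have hunit : IsUnit (1 - (z - w) • Q) := isUnit_one_sub_of_norm_lt_one h
  have hleft : ∀ y, Ring.inverse (1 - (z - w) • Q) ((1 - (z - w) • Q) y) = y :=
    DFunLike.congr_fun (Ring.inverse_mul_cancel _ hunit)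
  have hright : ∀ y, (1 - (z - w) • Q) (Ring.inverse (1 - (z - w) • Q) y) = y :=
    DFunLike.congr_fun (Ring.mul_inverse_cancel _ hunit)
  refine ⟨fun x => ?_, fun y => ?_⟩
  · have hx : T x - z • (x : H) = (1 - (z - w) • Q) (T x - w • (x : H)) := by
      simp only [sub_apply, one_apply_eq_self, smul_apply, hQ.1 x]
      module
    rw [hx, mul_apply_eq_comp, hleft, hQ.1 x]
  · rw [mul_apply_eq_comp]
    set v := Ring.inverse (1 - (z - w) • Q) y
    obtain ⟨hmem, hv⟩ := hQ.2 v
    refine ⟨hmem, ?_⟩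
    calc T ⟨Q v, hmem⟩ - z • Q v = (T ⟨Q v, hmem⟩ - w • Q v) - (z - w) • Q v := by module
      _ = (1 - (z - w) • Q) v := by rw [hv]; rfl
      _ = y := hright y

theorem isOpen_resSet (T : H →ₗ.[ℂ] H) : IsOpen (resSet T) := by
  rw [isOpen_iff_mem_nhds]
  rintro w ⟨Q, hQ⟩
  filter_upwards [eventually_norm_sub_smul_lt_one w Q] with z hz
  exact ⟨_, hQ.isResolventAt_of_norm_lt hz⟩

theorem continuousOn_resolvent (T : H →ₗ.[ℂ] H) : ContinuousOn (resolvent T) (resSet T) := by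
  rintro w ⟨Q, hQ⟩
  have hinv : ContinuousAt Ring.inverse (1 - (w - w) • Q) := by
    simpa using NormedRing.inverse_continuousAt (1 : (H →L[ℂ] H)ˣ)
  have hneumann : ContinuousAt (fun z => Q * Ring.inverse (1 - (z - w) • Q)) w :=
    continuousAt_const.mul
      (hinv.comp (f := fun z : ℂ => 1 - (z - w) • Q) (by fun_prop))
  refine (hneumann.congr ?_).continuousWithinAt
  filter_upwards [eventually_norm_sub_smul_lt_one w Q] with z hz
  exact (hQ.isResolventAt_of_norm_lt hz).resolvent_eq.symm

end Resolvent

/-! ### Contour integrals around a sector -/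

section DifferentiableIntegral

variable {α X : Type*} [MeasurableSpace α] {μ : Measure α}
  [NormedAddCommGroup X] [NormedSpace ℂ X] {F : ℂ → α → X} {z : ℂ} {r : ℝ}

theorem aestronglyMeasurable_deriv (hr : 0 < r)
    (hmeas : ∀ w ∈ Metric.ball z r, AEStronglyMeasurable (F w) μ)
    (hdiff : ∀ᵐ a ∂μ, DifferentiableOn ℂ (F · a) (Metric.ball z r)) :
    AEStronglyMeasurable (fun a => deriv (F · a) z) μ := by
  obtain ⟨u, -, hu, hlim⟩ := exists_seq_strictAnti_tendsto' hr
  have hu_mem : ∀ n, z + (u n : ℂ) ∈ Metric.ball z r := fun n => by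
    simpa [abs_of_pos (hu n).1] using (hu n).2
  have hu_lim : Tendsto (fun n => (u n : ℂ)) atTop (𝓝[≠] 0) := by
    refine tendsto_nhdsWithin_iff.2 ⟨?_, Eventually.of_forall fun n => ?_⟩
    · simpa [Function.comp_def] using (Complex.continuous_ofReal.tendsto 0).comp hlim
    · simpa using (hu n).1.ne'
  refine aestronglyMeasurable_of_tendsto_ae atTop
    (f := fun n a => (u n : ℂ)⁻¹ • (F (z + u n) a - F z a))
    (fun n => ((hmeas _ (hu_mem n)).sub (hmeas z (Metric.mem_ball_self hr))).const_smul _) ?_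
  filter_upwards [hdiff] with a ha
  have hderiv := (ha.differentiableAt (Metric.ball_mem_nhds z hr)).hasDerivAt
  exact hderiv.tendsto_slope_zero.comp hu_lim

theorem differentiableAt_integral_of_dominated {bound : α → ℝ} (hr : 0 < r)
    (hmeas : ∀ w ∈ Metric.ball z r, AEStronglyMeasurable (F w) μ)
    (hbound : ∀ᵐ a ∂μ, ∀ w ∈ Metric.ball z r, ‖F w a‖ ≤ bound a) (hint : Integrable bound μ)
    (hdiff : ∀ᵐ a ∂μ, DifferentiableOn ℂ (F · a) (Metric.ball z r)) :
    DifferentiableAt ℂ (fun w => ∫ a, F w a ∂μ) z := by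
  have hr2 : 0 < r / 2 := half_pos hr
  have hcauchy : ∀ᵐ a ∂μ, ∀ w ∈ Metric.ball z (r / 2),
      ‖deriv (F · a) w‖ ≤ bound a / (r / 4) := by
    filter_upwards [hbound, hdiff] with a hFa ha w hw
    have hsub : Metric.closedBall w (r / 4) ⊆ Metric.ball z r :=
      Metric.closedBall_subset_ball' (by have := Metric.mem_ball.1 hw; linarith)
    refine Complex.norm_deriv_le_of_forall_mem_sphere_norm_le (by positivity)
      (ha.diffContOnCl_ball hsub) fun v hv => hFa v (hsub (Metric.sphere_subset_closedBall hv))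
  have hz := Metric.mem_ball_self (x := z) hr
  have hFz : Integrable (F z) μ :=
    hint.mono' (hmeas z hz) (by filter_upwards [hbound] with a ha using ha z hz)
  refine (hasDerivAt_integral_of_dominated_loc_of_deriv_le (F' := fun w a => deriv (F · a) w)
    (Metric.ball_mem_nhds z hr2) ?_ hFz (aestronglyMeasurable_deriv hr hmeas hdiff) hcauchy
    (hint.div_const _) ?_).2.differentiableAt
  · filter_upwards [Metric.ball_mem_nhds z hr] with w hw using hmeas w hw
  · filter_upwards [hdiff] with a ha w hw
    have hw' : w ∈ Metric.ball z r := Metric.ball_subset_ball (by linarith) hw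
    exact (ha.differentiableAt (Metric.isOpen_ball.mem_nhds hw')).hasDerivAt

end DifferentiableIntegral

/-- The trace of the contour of a Dunford integral: the rays `{r e^{±iφ} | r ≥ δ}` and the arc
`{δ e^{it} | |t| ≤ φ}`. -/
def sectorContour (φ δ : ℝ) : Set ℂ :=
  {ζ | ∃ r t : ℝ, ζ = r * Complex.exp (t * Complex.I) ∧
    (δ ≤ r ∧ |t| = φ ∨ r = δ ∧ |t| ≤ φ)}

section Trace

variable {φ δ r t : ℝ} {ζ : ℂ}

theorem ray_mem_sectorContour (ht : |t| = φ) (hr : δ ≤ r) :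
    (r : ℂ) * Complex.exp (t * Complex.I) ∈ sectorContour φ δ :=
  ⟨r, t, rfl, Or.inl ⟨hr, ht⟩⟩

theorem arc_mem_sectorContour (ht : |t| ≤ φ) :
    (δ : ℂ) * Complex.exp (t * Complex.I) ∈ sectorContour φ δ :=
  ⟨δ, t, rfl, Or.inr ⟨rfl, ht⟩⟩

theorem norm_ofReal_mul_exp_mul_I (hr : 0 ≤ r) (t : ℝ) :
    ‖(r : ℂ) * Complex.exp (t * Complex.I)‖ = r := by
  rw [norm_mul, Complex.norm_exp_ofReal_mul_I, mul_one, Complex.norm_of_nonneg hr]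

theorem sectorContour_subset_slitPlane (hδ : 0 < δ) (hφ : φ < Real.pi) :
    sectorContour φ δ ⊆ Complex.slitPlane := by
  rintro _ ⟨r, t, rfl, h⟩
  have hr : 0 < r := h.elim (fun h => hδ.trans_le h.1) fun h => h.1 ▸ hδ
  have ht : |t| < Real.pi := (h.elim (fun h => h.2.le) And.right).trans_lt hφ
  have harg : ((r : ℂ) * Complex.exp (t * Complex.I)).arg = t := by
    rw [Complex.exp_mul_I, Complex.arg_mul_cos_add_sin_mul_I hr
      ⟨(abs_lt.1 ht).1, (abs_lt.1 ht).2.le⟩]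
  rw [Complex.mem_slitPlane_iff_arg, harg]
  exact ⟨(abs_lt.1 ht).2.ne,
    mul_ne_zero (Complex.ofReal_ne_zero.2 hr.ne') (Complex.exp_ne_zero _)⟩

theorem norm_cpow_neg_le (hζ : ζ ≠ 0) (z : ℂ) :
    ‖ζ ^ (-z)‖ ≤ ‖ζ‖ ^ (-z.re) * Real.exp (Real.pi * |z.im|) := by
  have harg : ζ.arg * z.im ≤ Real.pi * |z.im| :=
    calc ζ.arg * z.im ≤ |ζ.arg| * |z.im| := (le_abs_self _).trans (abs_mul _ _).le
      _ ≤ Real.pi * |z.im| := by gcongr; exact Complex.abs_arg_le_pi ζ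
  rw [Complex.norm_cpow_of_ne_zero hζ, div_eq_mul_inv, ← Real.exp_neg, Complex.neg_re,
    Complex.neg_im, mul_neg, neg_neg]
  gcongr

end Trace

/-- The integral `∮ f(ζ) dζ` over `sectorContour φ δ`, run through from `∞ e^{-iφ}` to
`∞ e^{iφ}`. -/
def sectorIntegral {X : Type*} [NormedAddCommGroup X] [NormedSpace ℂ X] (φ δ : ℝ) (f : ℂ → X) :
    X :=
  let u : ℝ → ℂ := fun t => Complex.exp (t * Complex.I);
  -(∫ r in Set.Ioi δ, u (-φ) • f (r * u (-φ)))
    + (∫ t in (-φ)..φ, (Complex.I * δ * u t) • f (δ * u t))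
    + ∫ r in Set.Ioi δ, u φ • f (r * u φ)

/-- Integrability of `f` over `sectorContour φ δ`: the three integrals which make up
`sectorIntegral φ δ f` exist. -/
structure SectorIntegrable {X : Type*} [NormedAddCommGroup X] [NormedSpace ℂ X] (φ δ : ℝ)
    (f : ℂ → X) : Prop where
  ray : ∀ t : ℝ, |t| = φ → IntegrableOn
    (fun r : ℝ => Complex.exp (t * Complex.I) • f (r * Complex.exp (t * Complex.I))) (Set.Ioi δ)
  arc : IntervalIntegrable (fun t : ℝ => (Complex.I * δ * Complex.exp (t * Complex.I)) •
    f (δ * Complex.exp (t * Complex.I))) volume (-φ) φ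

section ContourIntegral

variable {X Y : Type*} [NormedAddCommGroup X] [NormedSpace ℂ X]
  [NormedAddCommGroup Y] [NormedSpace ℂ Y] {φ δ : ℝ} {f g : ℂ → X}

theorem sectorIntegral_congr (hφ : 0 ≤ φ) (h : Set.EqOn f g (sectorContour φ δ)) :
    sectorIntegral φ δ f = sectorIntegral φ δ g := by
  have hray : ∀ t : ℝ, |t| = φ → ∀ r ∈ Set.Ioi δ,
      Complex.exp (t * Complex.I) • f (r * Complex.exp (t * Complex.I))
        = Complex.exp (t * Complex.I) • g (r * Complex.exp (t * Complex.I)) := fun t ht r hr => by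
    rw [h (ray_mem_sectorContour ht (le_of_lt hr))]
  have harc : ∀ t ∈ Set.uIcc (-φ) φ, (Complex.I * δ * Complex.exp (t * Complex.I)) •
      f (δ * Complex.exp (t * Complex.I)) = (Complex.I * δ * Complex.exp (t * Complex.I)) •
      g (δ * Complex.exp (t * Complex.I)) := fun t ht => by
    rw [Set.uIcc_of_le (neg_le_self hφ)] at ht
    rw [h (arc_mem_sectorContour (abs_le.2 ht))]
  simp only [sectorIntegral]
  rw [setIntegral_congr_fun measurableSet_Ioi (hray (-φ) (by rw [abs_neg, abs_of_nonneg hφ])),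
    setIntegral_congr_fun measurableSet_Ioi (hray φ (abs_of_nonneg hφ)),
    intervalIntegral.integral_congr harc]

theorem sectorIntegral_sub (hφ : 0 ≤ φ) (hf : SectorIntegrable φ δ f)
    (hg : SectorIntegrable φ δ g) :
    sectorIntegral φ δ (fun ζ => f ζ - g ζ) = sectorIntegral φ δ f - sectorIntegral φ δ g := by
  have hneg : |(-φ)| = φ := by rw [abs_neg, abs_of_nonneg hφ]
  have hpos : |φ| = φ := abs_of_nonneg hφ
  simp only [sectorIntegral, smul_sub]
  rw [integral_sub (hf.ray _ hneg) (hg.ray _ hneg), integral_sub (hf.ray _ hpos) (hg.ray _ hpos),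
    intervalIntegral.integral_sub hf.arc hg.arc]
  abel

theorem SectorIntegrable.smul_const {c : ℂ → ℂ} (hc : SectorIntegrable φ δ c) (x : X) :
    SectorIntegrable φ δ (fun ζ => c ζ • x) := by
  refine ⟨fun t ht => ?_, ?_⟩
  · simpa only [smul_smul, smul_eq_mul, IntegrableOn] using (hc.ray t ht).smul_const x
  · have harc := hc.arc
    rw [intervalIntegrable_iff] at harc ⊢
    simpa only [smul_smul, smul_eq_mul, IntegrableOn] using harc.smul_const x

theorem sectorIntegral_smul_const [CompleteSpace X] (c : ℂ → ℂ) (x : X) :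
    sectorIntegral φ δ (fun ζ => c ζ • x) = sectorIntegral φ δ c • x := by
  simp only [sectorIntegral, smul_smul, integral_smul_const, intervalIntegral.integral_smul_const,
    add_smul, neg_smul, smul_eq_mul]

theorem map_sectorIntegral [CompleteSpace X] [CompleteSpace Y] (L : X →L[ℂ] Y) (hφ : 0 ≤ φ)
    (hf : SectorIntegrable φ δ f) :
    L (sectorIntegral φ δ f) = sectorIntegral φ δ fun ζ => L (f ζ) := by
  simp only [sectorIntegral, map_add, map_neg, ← map_smul]
  rw [L.integral_comp_comm (hf.ray _ (by rw [abs_neg, abs_of_nonneg hφ])),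
    L.integral_comp_comm (hf.ray _ (abs_of_nonneg hφ)), L.intervalIntegral_comp_comm hf.arc]

end ContourIntegral

section Decay

variable {X : Type*} [NormedAddCommGroup X] [NormedSpace ℂ X] {φ δ C x : ℝ} {f : ℂ → X}

theorem norm_ray_integrand_le (hδ : 0 < δ)
    (hf : ∀ ζ ∈ sectorContour φ δ, ‖f ζ‖ ≤ C * ‖ζ‖ ^ (-x - 1)) {t : ℝ} (ht : |t| = φ)
    {r : ℝ} (hr : r ∈ Set.Ioi δ) :
    ‖Complex.exp (t * Complex.I) • f (r * Complex.exp (t * Complex.I))‖ ≤ C * r ^ (-x - 1) := by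
  have h := hf _ (ray_mem_sectorContour ht (le_of_lt hr))
  rw [norm_ofReal_mul_exp_mul_I (hδ.le.trans (le_of_lt hr))] at h
  rwa [norm_smul, Complex.norm_exp_ofReal_mul_I, one_mul]

theorem norm_arc_integrand_le (hδ : 0 < δ)
    (hf : ∀ ζ ∈ sectorContour φ δ, ‖f ζ‖ ≤ C * ‖ζ‖ ^ (-x - 1)) {t : ℝ} (ht : |t| ≤ φ) :
    ‖(Complex.I * δ * Complex.exp (t * Complex.I)) • f (δ * Complex.exp (t * Complex.I))‖
      ≤ C * δ ^ (-x) := by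
  have h := hf _ (arc_mem_sectorContour ht)
  rw [norm_ofReal_mul_exp_mul_I hδ.le] at h
  rw [norm_smul, mul_assoc, norm_mul, Complex.norm_I, one_mul, norm_ofReal_mul_exp_mul_I hδ.le]
  calc δ * ‖f (δ * Complex.exp (t * Complex.I))‖ ≤ δ * (C * δ ^ (-x - 1)) := by gcongr
    _ = C * δ ^ (-x) := by rw [Real.rpow_sub_one hδ.ne']; field_simp

theorem integrableOn_Ioi_mul_rpow (hδ : 0 < δ) (hx : 0 < x) (C : ℝ) :
    IntegrableOn (fun r : ℝ => C * r ^ (-x - 1)) (Set.Ioi δ) :=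
  (integrableOn_Ioi_rpow_of_lt (by linarith) hδ).const_mul C

theorem aestronglyMeasurable_ray_integrand (hf : ContinuousOn f (sectorContour φ δ)) {t : ℝ}
    (ht : |t| = φ) : AEStronglyMeasurable (fun r : ℝ =>
      Complex.exp (t * Complex.I) • f (r * Complex.exp (t * Complex.I)))
      (volume.restrict (Set.Ioi δ)) := by
  refine ContinuousOn.aestronglyMeasurable ?_ measurableSet_Ioi
  exact continuousOn_const.smul (hf.comp (by fun_prop) fun r hr =>
    ray_mem_sectorContour ht (le_of_lt hr))

theorem continuousOn_arc_integrand (hf : ContinuousOn f (sectorContour φ δ)) :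
    ContinuousOn (fun t : ℝ => (Complex.I * δ * Complex.exp (t * Complex.I)) •
      f (δ * Complex.exp (t * Complex.I))) (Set.Icc (-φ) φ) :=
  ContinuousOn.smul (by fun_prop) (hf.comp (by fun_prop) fun _ ht =>
    arc_mem_sectorContour (abs_le.2 ht))

theorem sectorIntegrable_of_decay (hδ : 0 < δ) (hφ : 0 ≤ φ) (hx : 0 < x)
    (hcont : ContinuousOn f (sectorContour φ δ))
    (hf : ∀ ζ ∈ sectorContour φ δ, ‖f ζ‖ ≤ C * ‖ζ‖ ^ (-x - 1)) : SectorIntegrable φ δ f where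
  ray _ ht := (integrableOn_Ioi_mul_rpow hδ hx C).mono'
    (aestronglyMeasurable_ray_integrand hcont ht)
    ((ae_restrict_iff' measurableSet_Ioi).2 <| Eventually.of_forall fun _ =>
      norm_ray_integrand_le hδ hf ht)
  arc := (continuousOn_arc_integrand hcont).intervalIntegrable_of_Icc (neg_le_self hφ)

theorem norm_sectorIntegral_le (hδ : 0 < δ) (hφ : 0 ≤ φ) (hx : 0 < x)
    (hf : ∀ ζ ∈ sectorContour φ δ, ‖f ζ‖ ≤ C * ‖ζ‖ ^ (-x - 1)) :
    ‖sectorIntegral φ δ f‖ ≤ C * (δ ^ (-x) * (2 / x + 2 * φ)) := by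
  have hray : ∀ t : ℝ, |t| = φ → ‖∫ r in Set.Ioi δ, Complex.exp (t * Complex.I) •
      f (r * Complex.exp (t * Complex.I))‖ ≤ C * (δ ^ (-x) / x) := fun t ht =>
    calc _ ≤ ∫ r in Set.Ioi δ, C * r ^ (-x - 1) :=
          norm_integral_le_of_norm_le (integrableOn_Ioi_mul_rpow hδ hx C)
            ((ae_restrict_iff' measurableSet_Ioi).2 <| Eventually.of_forall fun _ =>
              norm_ray_integrand_le hδ hf ht)
      _ = C * (δ ^ (-x) / x) := by
          rw [integral_const_mul, integral_Ioi_rpow_of_lt (by linarith) hδ, sub_add_cancel,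
            neg_div_neg_eq]
  have harc : ‖∫ t in (-φ)..φ, (Complex.I * δ * Complex.exp (t * Complex.I)) •
      f (δ * Complex.exp (t * Complex.I))‖ ≤ C * δ ^ (-x) * |φ - -φ| := by
    refine intervalIntegral.norm_integral_le_of_norm_le_const fun t ht => ?_
    rw [Set.uIoc_of_le (neg_le_self hφ)] at ht
    exact norm_arc_integrand_le hδ hf (abs_le.2 ⟨ht.1.le, ht.2⟩)
  rw [abs_of_nonneg (by linarith)] at harc
  refine (norm_add₃_le).trans ?_
  rw [norm_neg]
  refine (add_le_add_three (hray (-φ) (by rw [abs_neg, abs_of_nonneg hφ])) harc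
    (hray φ (abs_of_nonneg hφ))).trans_eq ?_
  ring

theorem differentiableAt_sectorIntegral {F : ℂ → ℂ → X} {z : ℂ} {ε : ℝ}
    (hδ : 0 < δ) (hφ : 0 ≤ φ) (hx : 0 < x) (hε : 0 < ε)
    (hcont : ∀ w ∈ Metric.ball z ε, ContinuousOn (F w) (sectorContour φ δ))
    (hF : ∀ w ∈ Metric.ball z ε, ∀ ζ ∈ sectorContour φ δ, ‖F w ζ‖ ≤ C * ‖ζ‖ ^ (-x - 1))
    (hdiff : ∀ ζ ∈ sectorContour φ δ, Differentiable ℂ (F · ζ)) :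
    DifferentiableAt ℂ (fun w => sectorIntegral φ δ (F w)) z := by
  have hray : ∀ t : ℝ, |t| = φ → DifferentiableAt ℂ (fun w => ∫ r in Set.Ioi δ,
      Complex.exp (t * Complex.I) • F w (r * Complex.exp (t * Complex.I))) z := fun t ht => by
    refine differentiableAt_integral_of_dominated hε
      (fun w hw => aestronglyMeasurable_ray_integrand (hcont w hw) ht)
      (bound := fun r => C * r ^ (-x - 1)) ?_ (integrableOn_Ioi_mul_rpow hδ hx C) ?_
    · exact (ae_restrict_iff' measurableSet_Ioi).2 <| Eventually.of_forall fun r hr w hw =>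
        norm_ray_integrand_le hδ (hF w hw) ht hr
    · exact (ae_restrict_iff' measurableSet_Ioi).2 <| Eventually.of_forall fun r hr =>
        ((hdiff _ (ray_mem_sectorContour ht (le_of_lt hr))).const_smul _).differentiableOn
  have harc : DifferentiableAt ℂ (fun w => ∫ t in (-φ)..φ,
      (Complex.I * δ * Complex.exp (t * Complex.I)) • F w (δ * Complex.exp (t * Complex.I))) z := by
    simp only [intervalIntegral.integral_of_le (neg_le_self hφ)]
    refine differentiableAt_integral_of_dominated hε
      (fun w hw => ((continuousOn_arc_integrand (hcont w hw)).mono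
        Set.Ioc_subset_Icc_self).aestronglyMeasurable measurableSet_Ioc)
      (bound := fun _ => C * δ ^ (-x)) ?_ (integrable_const _) ?_
    · exact (ae_restrict_iff' measurableSet_Ioc).2 <| Eventually.of_forall fun t ht w hw =>
        norm_arc_integrand_le hδ (hF w hw) (abs_le.2 ⟨ht.1.le, ht.2⟩)
    · exact (ae_restrict_iff' measurableSet_Ioc).2 <| Eventually.of_forall fun t ht =>
        ((hdiff _ (arc_mem_sectorContour (abs_le.2 ⟨ht.1.le, ht.2⟩))).const_smul
          _).differentiableOn
  exact ((hray (-φ) (by rw [abs_neg, abs_of_nonneg hφ])).neg.add harc).add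
    (hray φ (abs_of_nonneg hφ))

end Decay

section CpowIntegral

variable {φ δ : ℝ} {z : ℂ}

theorem hasDerivAt_neg_cpow_div (hz : z ≠ 0) {γ : ℝ → ℂ} {γ' : ℂ} {t : ℝ}
    (hγ : HasDerivAt γ γ' t) (hmem : γ t ∈ Complex.slitPlane) :
    HasDerivAt (fun t => -(γ t ^ (-z) / z)) (γ' • γ t ^ (-(z + 1))) t := by
  have hprim : HasDerivAt (fun ζ : ℂ => -(ζ ^ (-z) / z)) (γ t ^ (-(z + 1))) (γ t) := by
    refine ((((hasDerivAt_id _).cpow_const (c := -z) hmem).div_const z).neg).congr_deriv ?_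
    rw [id_eq, ← neg_add']
    field_simp
  exact hprim.scomp t hγ

theorem sectorIntegrable_cpow (hδ : 0 < δ) (hφ₀ : 0 ≤ φ) (hφ : φ < Real.pi) (hz : 0 < z.re) :
    SectorIntegrable φ δ (fun ζ => ζ ^ (-(z + 1))) := by
  have hslit := sectorContour_subset_slitPlane hδ hφ
  refine sectorIntegrable_of_decay (C := Real.exp (Real.pi * |z.im|)) hδ hφ₀ hz
    (fun ζ hζ => (continuousAt_cpow_const (hslit hζ)).continuousWithinAt) fun ζ hζ => ?_
  have h := norm_cpow_neg_le (Complex.slitPlane_ne_zero (hslit hζ)) (z + 1)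
  simp only [Complex.add_re, Complex.one_re, Complex.add_im, Complex.one_im, add_zero] at h
  rwa [mul_comm, ← neg_add']

theorem tendsto_ray_cpow_neg (hz : 0 < z.re) (t : ℝ) :
    Tendsto (fun r : ℝ => ((r : ℂ) * Complex.exp (t * Complex.I)) ^ (-z)) atTop (𝓝 0) := by
  have hlim := (tendsto_rpow_neg_atTop hz).mul_const (Real.exp (Real.pi * |z.im|))
  rw [zero_mul] at hlim
  refine squeeze_zero_norm' ?_ hlim
  filter_upwards [eventually_gt_atTop 0] with r hr
  have hne : (r : ℂ) * Complex.exp (t * Complex.I) ≠ 0 :=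
    mul_ne_zero (Complex.ofReal_ne_zero.2 hr.ne') (Complex.exp_ne_zero _)
  simpa only [norm_ofReal_mul_exp_mul_I hr.le] using norm_cpow_neg_le hne z

theorem integral_ray_cpow (hδ : 0 < δ) (hφ : φ < Real.pi) {t : ℝ} (ht : |t| = φ) (hz : 0 < z.re) :
    ∫ r in Set.Ioi δ, Complex.exp (t * Complex.I) •
      ((r : ℂ) * Complex.exp (t * Complex.I)) ^ (-(z + 1))
      = (δ * Complex.exp (t * Complex.I)) ^ (-z) / z := by
  have hz₀ : z ≠ 0 := fun h => by simp [h] at hz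
  have hφ₀ : 0 ≤ φ := ht ▸ abs_nonneg t
  have hderiv : ∀ r ∈ Set.Ici δ, HasDerivAt
      (fun r : ℝ => -(((r : ℂ) * Complex.exp (t * Complex.I)) ^ (-z) / z))
      (Complex.exp (t * Complex.I) • ((r : ℂ) * Complex.exp (t * Complex.I)) ^ (-(z + 1))) r :=
    fun r hr => hasDerivAt_neg_cpow_div hz₀
      (by simpa using (Complex.ofRealCLM.hasDerivAt (x := r)).mul_const _)
      (sectorContour_subset_slitPlane hδ hφ (ray_mem_sectorContour ht hr))
  have hlim := ((tendsto_ray_cpow_neg hz t).div_const z).neg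
  rw [integral_Ioi_of_hasDerivAt_of_tendsto' hderiv
    ((sectorIntegrable_cpow hδ hφ₀ hφ hz).ray t ht) hlim]
  simp

theorem integral_arc_cpow (hδ : 0 < δ) (hφ₀ : 0 ≤ φ) (hφ : φ < Real.pi) (hz : 0 < z.re) :
    ∫ t in (-φ)..φ, (Complex.I * δ * Complex.exp (t * Complex.I)) •
      ((δ : ℂ) * Complex.exp (t * Complex.I)) ^ (-(z + 1))
      = (δ * Complex.exp ((-φ : ℝ) * Complex.I)) ^ (-z) / z
        - (δ * Complex.exp (φ * Complex.I)) ^ (-z) / z := by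
  have hz₀ : z ≠ 0 := fun h => by simp [h] at hz
  have hderiv : ∀ t ∈ Set.uIcc (-φ) φ, HasDerivAt
      (fun t : ℝ => -(((δ : ℂ) * Complex.exp (t * Complex.I)) ^ (-z) / z))
      ((Complex.I * δ * Complex.exp (t * Complex.I)) •
        ((δ : ℂ) * Complex.exp (t * Complex.I)) ^ (-(z + 1))) t := fun t ht => by
    rw [Set.uIcc_of_le (neg_le_self hφ₀)] at ht
    refine hasDerivAt_neg_cpow_div hz₀ ?_
      (sectorContour_subset_slitPlane hδ hφ (arc_mem_sectorContour (abs_le.2 ht)))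
    have hexp := ((Complex.ofRealCLM.hasDerivAt (x := t)).mul_const Complex.I).cexp
    refine (hexp.const_mul (δ : ℂ)).congr_deriv ?_
    simp only [Complex.ofRealCLM_apply, Complex.ofReal_one]
    ring
  rw [intervalIntegral.integral_eq_sub_of_hasDerivAt hderiv
    (sectorIntegrable_cpow hδ hφ₀ hφ hz).arc]
  ring

theorem sectorIntegral_cpow_eq_zero (hδ : 0 < δ) (hφ₀ : 0 ≤ φ) (hφ : φ < Real.pi)
    (hz : 0 < z.re) : sectorIntegral φ δ (fun ζ => ζ ^ (-(z + 1))) = 0 := by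
  simp only [sectorIntegral]
  rw [integral_ray_cpow hδ hφ (by rw [abs_neg, abs_of_nonneg hφ₀]) hz,
    integral_ray_cpow hδ hφ (abs_of_nonneg hφ₀) hz, integral_arc_cpow hδ hφ₀ hφ hz]
  ring

end CpowIntegral

section CpowSMul

variable {X : Type*} [NormedAddCommGroup X] [NormedSpace ℂ X] {φ δ C : ℝ} {g : ℂ → X} {z : ℂ}

theorem norm_cpow_neg_smul_le (hδ : 0 < δ) (hφ : φ < Real.pi)
    (hg : ∀ ζ ∈ sectorContour φ δ, ‖g ζ‖ ≤ C * ‖ζ‖⁻¹) (z : ℂ) :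
    ∀ ζ ∈ sectorContour φ δ, ‖ζ ^ (-z) • g ζ‖
      ≤ C * Real.exp (Real.pi * |z.im|) * ‖ζ‖ ^ (-z.re - 1) := fun ζ hζ => by
  have hζ₀ : ζ ≠ 0 := Complex.slitPlane_ne_zero (sectorContour_subset_slitPlane hδ hφ hζ)
  rw [norm_smul, Real.rpow_sub_one (norm_ne_zero_iff.2 hζ₀)]
  calc ‖ζ ^ (-z)‖ * ‖g ζ‖
      ≤ (‖ζ‖ ^ (-z.re) * Real.exp (Real.pi * |z.im|)) * (C * ‖ζ‖⁻¹) :=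
        mul_le_mul (norm_cpow_neg_le hζ₀ z) (hg ζ hζ) (norm_nonneg _) (by positivity)
    _ = _ := by ring

theorem continuousOn_cpow_neg_smul (hδ : 0 < δ) (hφ : φ < Real.pi)
    (hg : ContinuousOn g (sectorContour φ δ)) (z : ℂ) :
    ContinuousOn (fun ζ => ζ ^ (-z) • g ζ) (sectorContour φ δ) :=
  ContinuousOn.smul (fun _ hζ => (continuousAt_cpow_const
    (sectorContour_subset_slitPlane hδ hφ hζ)).continuousWithinAt) hg

theorem sectorIntegrable_cpow_neg_smul (hδ : 0 < δ) (hφ₀ : 0 ≤ φ) (hφ : φ < Real.pi)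
    (hcont : ContinuousOn g (sectorContour φ δ))
    (hg : ∀ ζ ∈ sectorContour φ δ, ‖g ζ‖ ≤ C * ‖ζ‖⁻¹) (hz : 0 < z.re) :
    SectorIntegrable φ δ (fun ζ => ζ ^ (-z) • g ζ) :=
  sectorIntegrable_of_decay hδ hφ₀ hz (continuousOn_cpow_neg_smul hδ hφ hcont z)
    (norm_cpow_neg_smul_le hδ hφ hg z)

theorem norm_le_of_mem_sectorContour (hδ : 0 < δ) {ζ : ℂ} (hζ : ζ ∈ sectorContour φ δ) :
    δ ≤ ‖ζ‖ := by
  obtain ⟨r, t, rfl, h⟩ := hζ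
  have hr : δ ≤ r := h.elim And.left fun h => h.1.ge
  rwa [norm_ofReal_mul_exp_mul_I (hδ.le.trans hr)]

theorem rpow_neg_sub_one_le {r x y c : ℝ} (hδ : 0 < δ) (hr : δ ≤ r) (hxy : x ≤ y)
    (hyc : y - x ≤ c) : r ^ (-y - 1) ≤ Real.exp (c * |Real.log δ|) * r ^ (-x - 1) := by
  have hr₀ : 0 < r := hδ.trans_le hr
  have hpow : r ^ (-(y - x)) ≤ Real.exp (c * |Real.log δ|) :=
    calc r ^ (-(y - x)) ≤ δ ^ (-(y - x)) :=
          Real.rpow_le_rpow_of_nonpos hδ hr (by linarith)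
      _ = Real.exp ((y - x) * -Real.log δ) := by rw [Real.rpow_def_of_pos hδ]; ring_nf
      _ ≤ Real.exp ((y - x) * |Real.log δ|) := by
          have := sub_nonneg.2 hxy
          gcongr
          exact neg_le_abs _
      _ ≤ Real.exp (c * |Real.log δ|) := by gcongr
  calc r ^ (-y - 1) = r ^ (-(y - x)) * r ^ (-x - 1) := by rw [← Real.rpow_add hr₀]; ring_nf
    _ ≤ _ := by gcongr

theorem differentiableAt_sectorIntegral_cpow_neg_smul (hδ : 0 < δ)
    (hφ₀ : 0 ≤ φ) (hφ : φ < Real.pi) (hC : 0 ≤ C) (hcont : ContinuousOn g (sectorContour φ δ))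
    (hg : ∀ ζ ∈ sectorContour φ δ, ‖g ζ‖ ≤ C * ‖ζ‖⁻¹) (hz : 0 < z.re) :
    DifferentiableAt ℂ (fun z => sectorIntegral φ δ fun ζ => ζ ^ (-z) • g ζ) z := by
  refine differentiableAt_sectorIntegral (x := z.re / 2) (ε := z.re / 2)
    (C := C * Real.exp (Real.pi * (|z.im| + z.re / 2)) * Real.exp (z.re * |Real.log δ|))
    hδ hφ₀ (half_pos hz) (half_pos hz)
    (fun w _ => continuousOn_cpow_neg_smul hδ hφ hcont w) (fun w hw ζ hζ => ?_) fun ζ hζ => ?_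
  · rw [mem_ball_iff_norm] at hw
    have hre : |w.re - z.re| < z.re / 2 := (Complex.abs_re_le_norm (w - z)).trans_lt hw
    have him : |w.im - z.im| < z.re / 2 := (Complex.abs_im_le_norm (w - z)).trans_lt hw
    have him' : |w.im| ≤ |z.im| + z.re / 2 := by
      linarith [abs_sub_abs_le_abs_sub w.im z.im]
    obtain ⟨hre₁, hre₂⟩ := abs_lt.1 hre
    calc ‖ζ ^ (-w) • g ζ‖
        ≤ C * Real.exp (Real.pi * |w.im|) * ‖ζ‖ ^ (-w.re - 1) :=
          norm_cpow_neg_smul_le hδ hφ hg w ζ hζ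
      _ ≤ C * Real.exp (Real.pi * (|z.im| + z.re / 2)) *
            (Real.exp (z.re * |Real.log δ|) * ‖ζ‖ ^ (-(z.re / 2) - 1)) := by
          gcongr
          exact rpow_neg_sub_one_le hδ (norm_le_of_mem_sectorContour hδ hζ) (by linarith)
            (by linarith)
      _ = _ := by ring
  · have hζ₀ : ζ ≠ 0 := Complex.slitPlane_ne_zero (sectorContour_subset_slitPlane hδ hφ hζ)
    exact (differentiable_neg.const_cpow (Or.inl hζ₀)).smul_const (g ζ)

end CpowSMul

/-! ### Dunford integrals -/

theorem norm_mul_cos_le_of_mem_closure_sector {ω : ℝ} (hπ : ω ≤ Real.pi) {z : ℂ}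
    (hz : z ∈ closure (sector ω)) : ‖z‖ * Real.cos ω ≤ z.re := by
  have hcl : IsClosed {z : ℂ | ‖z‖ * Real.cos ω ≤ z.re} :=
    isClosed_le (by fun_prop) (by fun_prop)
  refine closure_minimal (fun w hw => ?_) hcl hz
  rw [Set.mem_ofPred_eq]
  by_cases hω : ω = 0
  · rw [sector, if_pos hω] at hw
    have hreal : w = (w.re : ℂ) := Complex.ext rfl hw.2
    rw [hω, Real.cos_zero, mul_one, hreal, Complex.norm_of_nonneg hw.1.le, Complex.ofReal_re]
  · rw [sector, if_neg hω] at hw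
    have hcos : Real.cos ω ≤ Real.cos w.arg := by
      rw [← Real.cos_abs w.arg]
      exact Real.cos_le_cos_of_nonneg_of_le_pi (abs_nonneg _) hπ hw.2.le
    rw [← Complex.norm_mul_cos_arg w]
    gcongr

theorem ray_notMem_closure_sector {ω t r : ℝ} (hω : 0 ≤ ω) (ht : ω < |t|) (hπ : |t| ≤ Real.pi)
    (hr : 0 < r) : (r : ℂ) * Complex.exp (t * Complex.I) ∉ closure (sector ω) := fun h => by
  have hle : r * Real.cos ω ≤ r * Real.cos t := by
    have h' := norm_mul_cos_le_of_mem_closure_sector (ht.le.trans hπ) h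
    rwa [norm_ofReal_mul_exp_mul_I hr.le, Complex.re_ofReal_mul,
      Complex.exp_ofReal_mul_I_re] at h'
  have hlt : Real.cos t < Real.cos ω := by
    rw [← Real.cos_abs t]
    exact Real.cos_lt_cos_of_nonneg_of_le_pi hω hπ ht
  exact (le_of_mul_le_mul_left hle hr).not_gt hlt

section Dunford

variable {H : Type*} [NormedAddCommGroup H] [InnerProductSpace ℂ H] {T : H →ₗ.[ℂ] H} {φ δ : ℝ}

theorem IsAdmissibleContour.angle_pos (hc : IsAdmissibleContour T φ δ) : 0 < φ := by
  obtain ⟨ω, hω, hT⟩ := hc.angle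
  exact hT.angle_nonneg.trans_lt hω

theorem IsAdmissibleContour.sectorContour_subset_resSet (hc : IsAdmissibleContour T φ δ) :
    sectorContour φ δ ⊆ resSet T := by
  rintro _ ⟨r, t, rfl, ⟨hr, ht⟩ | ⟨rfl, -⟩⟩
  · obtain ⟨ω, hω, hT⟩ := hc.angle
    by_contra h
    exact ray_notMem_closure_sector hT.angle_nonneg (ht ▸ hω) (ht ▸ hc.angle_lt_pi.le)
      (hc.radius_pos.trans_le hr) (hT.spectrum_subset h)
  · exact hc.ball_subset (mem_closedBall_zero_iff.2
      (norm_ofReal_mul_exp_mul_I hc.radius_pos.le t).le)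

theorem IsAdmissibleContour.exists_norm_resolvent_ray_le (hc : IsAdmissibleContour T φ δ) :
    ∃ C : ℝ, ∀ t r : ℝ, |t| = φ → 0 < r →
      ‖resolvent T (r * Complex.exp (t * Complex.I))‖ ≤ C * r⁻¹ := by
  obtain ⟨ω, hω, hT⟩ := hc.angle
  have hω₀ := hT.angle_nonneg
  have hπ := hc.angle_lt_pi
  obtain ⟨C, hC⟩ := hT.resolvent_bound ((ω + φ) / 2) (by linarith) (by linarith)
  refine ⟨C, fun t r ht hr => ?_⟩
  have h := hC _ (ray_notMem_closure_sector (ω := (ω + φ) / 2) (t := t) (by linarith)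
    (by rw [ht]; linarith) (ht ▸ hπ.le) hr)
  rw [norm_smul, norm_ofReal_mul_exp_mul_I hr.le] at h
  rwa [← div_eq_mul_inv, le_div_iff₀' hr]

variable [CompleteSpace H]

theorem exists_isAdmissibleContour (hT : IsSectorial T) (h0 : (0 : ℂ) ∈ resSet T) :
    ∃ c : ℝ × ℝ, IsAdmissibleContour T c.1 c.2 := by
  obtain ⟨ω, hω⟩ := hT
  obtain ⟨δ, hδ, hball⟩ :=
    Metric.nhds_basis_closedBall.mem_iff.1 ((isOpen_resSet T).mem_nhds h0)
  obtain ⟨φ, hωφ, hφ⟩ := exists_between hω.angle_lt_pi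
  exact ⟨(φ, δ), ⟨ω, hωφ, hω⟩, hφ, hδ, hball⟩

theorem IsAdmissibleContour.continuousOn_resolvent (hc : IsAdmissibleContour T φ δ) :
    ContinuousOn (resolvent T) (sectorContour φ δ) :=
  (SectorialInterpolation.continuousOn_resolvent T).mono hc.sectorContour_subset_resSet

theorem IsAdmissibleContour.exists_norm_resolvent_le (hc : IsAdmissibleContour T φ δ) :
    ∃ C : ℝ, 0 ≤ C ∧ ∀ ζ ∈ sectorContour φ δ, ‖resolvent T ζ‖ ≤ C * ‖ζ‖⁻¹ := by
  have hδ := hc.radius_pos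
  obtain ⟨C₁, hC₁⟩ := hc.exists_norm_resolvent_ray_le
  have harc : ContinuousOn (fun t : ℝ => resolvent T (δ * Complex.exp (t * Complex.I)))
      (Set.Icc (-φ) φ) :=
    hc.continuousOn_resolvent.comp (by fun_prop) fun t ht =>
      arc_mem_sectorContour (abs_le.2 ht)
  obtain ⟨C₂, hC₂⟩ := isCompact_Icc.exists_bound_of_continuousOn harc
  refine ⟨max 0 (max C₁ (C₂ * δ)), le_max_left _ _, ?_⟩
  rintro _ ⟨r, t, rfl, ⟨hr, ht⟩ | ⟨rfl, ht⟩⟩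
  · have hr₀ : 0 < r := hδ.trans_le hr
    rw [norm_ofReal_mul_exp_mul_I hr₀.le]
    refine (hC₁ t r ht hr₀).trans ?_
    gcongr
    exact (le_max_left _ _).trans (le_max_right _ _)
  · rw [norm_ofReal_mul_exp_mul_I hδ.le]
    calc _ ≤ C₂ := hC₂ t (abs_le.1 ht)
      _ = C₂ * r * r⁻¹ := (mul_inv_cancel_right₀ hδ.ne' C₂).symm
      _ ≤ _ := by gcongr; exact (le_max_right _ _).trans (le_max_right _ _)

theorem dunfordIntegral_eq_sectorIntegral (T : H →ₗ.[ℂ] H) (φ δ : ℝ) (z : ℂ) :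
    dunfordIntegral T φ δ z = (2 * Real.pi * Complex.I)⁻¹ •
      sectorIntegral φ δ fun ζ => ζ ^ (-z) • resolvent T ζ :=
  rfl

theorem differentiableAt_dunfordIntegral (hc : IsAdmissibleContour T φ δ) {z : ℂ}
    (hz : 0 < z.re) : DifferentiableAt ℂ (dunfordIntegral T φ δ) z := by
  obtain ⟨C, hC₀, hC⟩ := hc.exists_norm_resolvent_le
  exact (differentiableAt_sectorIntegral_cpow_neg_smul hc.radius_pos hc.angle_pos.le
    hc.angle_lt_pi hC₀ hc.continuousOn_resolvent hC hz).const_smul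
    ((2 * Real.pi * Complex.I)⁻¹ : ℂ)

theorem exists_norm_dunfordIntegral_le (hc : IsAdmissibleContour T φ δ) {a b : ℝ} (ha : 0 < a) :
    ∃ C : ℝ, ∀ z : ℂ, z.re ∈ Set.Icc a b →
      ‖dunfordIntegral T φ δ z‖ ≤ C * Real.exp (Real.pi * |z.im|) := by
  have hδ := hc.radius_pos
  obtain ⟨C, hC₀, hC⟩ := hc.exists_norm_resolvent_le
  have hcont : ContinuousOn (fun x : ℝ => δ ^ (-x) * (2 / x + 2 * φ)) (Set.Icc a b) := fun x hx =>
    have hx₀ : x ≠ 0 := (ha.trans_le hx.1).ne'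
    have hpow : Continuous fun x : ℝ => δ ^ (-x) :=
      continuous_const.rpow continuous_neg fun _ => Or.inl hδ.ne'
    (hpow.continuousAt.mul (by fun_prop (disch := exact hx₀))).continuousWithinAt
  obtain ⟨M, hM⟩ := isCompact_Icc.exists_bound_of_continuousOn hcont
  refine ⟨‖(2 * Real.pi * Complex.I : ℂ)⁻¹‖ * (C * M), fun z hz => ?_⟩
  rw [dunfordIntegral_eq_sectorIntegral, norm_smul, mul_assoc _ (C * M)]
  gcongr
  calc _ ≤ C * Real.exp (Real.pi * |z.im|) * (δ ^ (-z.re) * (2 / z.re + 2 * φ)) :=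
        norm_sectorIntegral_le hδ hc.angle_pos.le (ha.trans_le hz.1)
          (norm_cpow_neg_smul_le hδ hc.angle_lt_pi hC z)
    _ ≤ C * Real.exp (Real.pi * |z.im|) * M := by
        gcongr
        exact (le_abs_self _).trans (hM _ hz)
    _ = _ := by ring

/-- The resolvent identity turns `T⁻¹` under the integral sign into division by `ζ`; the
remaining term is a multiple of `∮ ζ^{-z-1} dζ = 0`. -/
theorem map_dunfordIntegral (hc : IsAdmissibleContour T φ δ) {Q : H →L[ℂ] H}
    (L : (H →L[ℂ] H) →L[ℂ] (H →L[ℂ] H))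
    (hL : ∀ ζ ∈ resSet T, ζ ≠ 0 → L (resolvent T ζ) = ζ⁻¹ • (resolvent T ζ - Q)) {z : ℂ}
    (hz : 0 < z.re) : L (dunfordIntegral T φ δ z) = dunfordIntegral T φ δ (z + 1) := by
  have hδ := hc.radius_pos
  have hφ₀ := hc.angle_pos.le
  have hφ := hc.angle_lt_pi
  obtain ⟨C, -, hC⟩ := hc.exists_norm_resolvent_le
  have hint : ∀ {w : ℂ}, 0 < w.re → SectorIntegrable φ δ fun ζ => ζ ^ (-w) • resolvent T ζ :=
    fun hw => sectorIntegrable_cpow_neg_smul hδ hφ₀ hφ hc.continuousOn_resolvent hC hw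
  have hcongr : Set.EqOn (fun ζ => L (ζ ^ (-z) • resolvent T ζ))
      (fun ζ => ζ ^ (-(z + 1)) • resolvent T ζ - ζ ^ (-(z + 1)) • Q) (sectorContour φ δ) := by
    intro ζ hζ
    have hζ₀ : ζ ≠ 0 := Complex.slitPlane_ne_zero (sectorContour_subset_slitPlane hδ hφ hζ)
    simp only [map_smul, hL ζ (hc.sectorContour_subset_resSet hζ) hζ₀, ← smul_sub, smul_smul,
      neg_add, Complex.cpow_add _ _ hζ₀, Complex.cpow_neg_one]
  rw [dunfordIntegral_eq_sectorIntegral, dunfordIntegral_eq_sectorIntegral, map_smul,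
    map_sectorIntegral L hφ₀ (hint hz), sectorIntegral_congr hφ₀ hcongr,
    sectorIntegral_sub hφ₀ (hint (by simpa using by linarith))
      ((sectorIntegrable_cpow hδ hφ₀ hφ hz).smul_const Q),
    sectorIntegral_smul_const, sectorIntegral_cpow_eq_zero hδ hφ₀ hφ hz, zero_smul, sub_zero]

end Dunford

/-! ### Bounded powers -/

section OfBounded

variable {E F : Type*} [NormedAddCommGroup E] [InnerProductSpace ℂ E]
  [NormedAddCommGroup F] [InnerProductSpace ℂ F]

theorem apply_of_eq_ofBounded {A : E →ₗ.[ℂ] F} {B : E →L[ℂ] F} (h : A = ofBounded B) (x : E)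
    (hx : x ∈ A.domain) : A ⟨x, hx⟩ = B x := by
  subst h
  rfl

theorem ofBounded_injective : Function.Injective (ofBounded : (E →L[ℂ] F) → E →ₗ.[ℂ] F) :=
  fun A _ h => ContinuousLinearMap.ext fun x => apply_of_eq_ofBounded (A := ofBounded A) h x trivial

end OfBounded

section Powers

variable {H : Type*} [NormedAddCommGroup H] [InnerProductSpace ℂ H]
  {T : H →ₗ.[ℂ] H} {Q B : H →L[ℂ] H} {N θ : ℝ} {z : ℂ}

open Classical in
/-- The power `T^{-z}` as an element of `B(H)`: the bounded operator represented by `negPow T z`,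
or `0` if `negPow T z` is not bounded and everywhere defined. -/
def boundedNegPow (T : H →ₗ.[ℂ] H) (z : ℂ) : H →L[ℂ] H :=
  if h : ∃ B : H →L[ℂ] H, negPow T z = ofBounded B then h.choose else 0

theorem boundedNegPow_eq (h : negPow T z = ofBounded B) : boundedNegPow T z = B := by
  have hex : ∃ B : H →L[ℂ] H, negPow T z = ofBounded B := ⟨B, h⟩
  rw [boundedNegPow, dif_pos hex]
  exact ofBounded_injective (hex.choose_spec.symm.trans h)

theorem boundedNegPow_of_re_pos (hz : 0 < z.re) : boundedNegPow T z = dunfordPow T z :=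
  boundedNegPow_eq (if_pos hz)

theorem HasBIP.exists_of_re_eq_zero (hBIP : HasBIP T N θ) (hz : z.re = 0) :
    ∃ B : H →L[ℂ] H, negPow T z = ofBounded B ∧ ‖B‖ ≤ N * Real.exp (θ * |z.im|) := by
  obtain ⟨B, hB, hBN⟩ := hBIP.bounded (-z.im)
  rw [abs_neg] at hBN
  exact ⟨B, (if_neg hz.not_gt).trans hB, hBN⟩

theorem HasBIP.negPow_eq (hBIP : HasBIP T N θ) (hz : 0 ≤ z.re) :
    negPow T z = ofBounded (boundedNegPow T z) := by
  rcases hz.lt_or_eq with hpos | hzero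
  · rw [boundedNegPow_of_re_pos hpos, negPow, if_pos hpos]
  · obtain ⟨B, hB, -⟩ := hBIP.exists_of_re_eq_zero hzero.symm
    rw [boundedNegPow_eq hB, hB]

theorem HasBIP.norm_boundedNegPow_le (hBIP : HasBIP T N θ) (hz : z.re = 0) :
    ‖boundedNegPow T z‖ ≤ N * Real.exp (θ * |z.im|) := by
  obtain ⟨B, hB, hBN⟩ := hBIP.exists_of_re_eq_zero hz
  rwa [boundedNegPow_eq hB]

theorem HasBIP.tendsto_dunfordPow (hBIP : HasBIP T N θ) (hz : z.re = 0) (f : H) :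
    Tendsto (fun w => dunfordPow T w f) (𝓝[{w : ℂ | 0 < w.re}] z)
      (𝓝 (boundedNegPow T z f)) := by
  have hB : imagPow T (-z.im) = ofBounded (boundedNegPow T z) :=
    (if_neg hz.not_gt).symm.trans (hBIP.negPow_eq hz.ge)
  have hf : f ∈ (imagPow T (-z.im)).domain := by rw [hB]; trivial
  have happroach : approach (-z.im) = 𝓝[{w : ℂ | 0 < w.re}] z := by
    rw [approach]
    congr 1
    apply Complex.ext <;> simp [hz]
  rw [← apply_of_eq_ofBounded hB f hf, ← happroach]
  exact hf.choose_spec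

theorem boundedNegPow_add_one (hz : 0 ≤ z.re) :
    boundedNegPow T (z + 1) = dunfordPow T (z + 1) :=
  boundedNegPow_of_re_pos (by simpa using add_pos_of_nonneg_of_pos hz one_pos)

variable [CompleteSpace H]

theorem exists_dunfordPow_eq (hT : IsSectorial T) (h0 : (0 : ℂ) ∈ resSet T) :
    ∃ φ δ : ℝ, IsAdmissibleContour T φ δ ∧ dunfordPow T = dunfordIntegral T φ δ := by
  have h := exists_isAdmissibleContour hT h0
  refine ⟨h.choose.1, h.choose.2, h.choose_spec, ?_⟩
  ext1 z
  rw [dunfordPow, dif_pos h]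

theorem differentiableAt_dunfordPow (hT : IsSectorial T) (h0 : (0 : ℂ) ∈ resSet T)
    (hz : 0 < z.re) : DifferentiableAt ℂ (dunfordPow T) z := by
  obtain ⟨φ, δ, hc, h⟩ := exists_dunfordPow_eq hT h0
  rw [h]
  exact differentiableAt_dunfordIntegral hc hz

theorem exists_norm_dunfordPow_le (hT : IsSectorial T) (h0 : (0 : ℂ) ∈ resSet T) {a b : ℝ}
    (ha : 0 < a) : ∃ C : ℝ, ∀ z : ℂ, z.re ∈ Set.Icc a b →
      ‖dunfordPow T z‖ ≤ C * Real.exp (Real.pi * |z.im|) := by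
  obtain ⟨φ, δ, hc, h⟩ := exists_dunfordPow_eq hT h0
  rw [h]
  exact exists_norm_dunfordIntegral_le hc ha

theorem inverse_mul_dunfordPow (hT : IsSectorial T) (hQ : IsResolventAt T 0 Q)
    (hz : 0 < z.re) : Q * dunfordPow T z = dunfordPow T (z + 1) := by
  obtain ⟨φ, δ, hc, h⟩ := exists_dunfordPow_eq hT ⟨Q, hQ⟩
  rw [h]
  exact map_dunfordIntegral hc (ContinuousLinearMap.mul ℂ (H →L[ℂ] H) Q)
    (fun ζ hζ h0 => (isResolventAt_resolvent hζ).inverse_mul hQ h0) hz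

theorem dunfordPow_mul_inverse (hT : IsSectorial T) (hQ : IsResolventAt T 0 Q)
    (hz : 0 < z.re) : dunfordPow T z * Q = dunfordPow T (z + 1) := by
  obtain ⟨φ, δ, hc, h⟩ := exists_dunfordPow_eq hT ⟨Q, hQ⟩
  rw [h]
  exact map_dunfordIntegral hc ((ContinuousLinearMap.mul ℂ (H →L[ℂ] H)).flip Q)
    (fun ζ hζ h0 => (isResolventAt_resolvent hζ).mul_inverse hQ h0) hz

theorem tendsto_dunfordPow_add_one (hT : IsSectorial T) (h0 : (0 : ℂ) ∈ resSet T)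
    (hz : 0 ≤ z.re) (f : H) :
    Tendsto (fun w => dunfordPow T (w + 1) f) (𝓝[{w : ℂ | 0 < w.re}] z)
      (𝓝 (dunfordPow T (z + 1) f)) := by
  have hcont : ContinuousAt (dunfordPow T) (z + 1) :=
    (differentiableAt_dunfordPow hT h0
      (by simpa using add_pos_of_nonneg_of_pos hz one_pos)).continuousAt
  have hshift : ContinuousAt (fun w => dunfordPow T (w + 1)) z :=
    hcont.comp (f := fun w => w + 1) (by fun_prop)
  exact (hshift.clm_apply continuousAt_const).tendsto.mono_left nhdsWithin_le_nhds

theorem neBot_nhdsWithin_re_pos (hz : 0 ≤ z.re) : (𝓝[{w : ℂ | 0 < w.re}] z).NeBot := by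
  rw [← mem_closure_iff_nhdsWithin_neBot, Complex.closure_setOfPred_lt_re]
  exact hz

theorem HasBIP.inverse_mul_boundedNegPow (hBIP : HasBIP T N θ) (hT : IsSectorial T)
    (hQ : IsResolventAt T 0 Q) (hz : 0 ≤ z.re) :
    Q * boundedNegPow T z = boundedNegPow T (z + 1) := by
  rw [boundedNegPow_add_one hz]
  rcases hz.lt_or_eq with hpos | hzero
  · rw [boundedNegPow_of_re_pos hpos, inverse_mul_dunfordPow hT hQ hpos]
  · have := neBot_nhdsWithin_re_pos hz
    ext f
    refine tendsto_nhds_unique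
      (((Q.continuous.tendsto _).comp (hBIP.tendsto_dunfordPow hzero.symm f)).congr' ?_)
      (tendsto_dunfordPow_add_one hT ⟨Q, hQ⟩ hz f)
    filter_upwards [self_mem_nhdsWithin] with w hw
    rw [← inverse_mul_dunfordPow hT hQ hw]
    rfl

theorem HasBIP.boundedNegPow_mul_inverse (hBIP : HasBIP T N θ) (hT : IsSectorial T)
    (hQ : IsResolventAt T 0 Q) (hz : 0 ≤ z.re) :
    boundedNegPow T z * Q = boundedNegPow T (z + 1) := by
  rw [boundedNegPow_add_one hz]
  rcases hz.lt_or_eq with hpos | hzero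
  · rw [boundedNegPow_of_re_pos hpos, dunfordPow_mul_inverse hT hQ hpos]
  · have := neBot_nhdsWithin_re_pos hz
    ext f
    refine tendsto_nhds_unique ((hBIP.tendsto_dunfordPow hzero.symm (Q f)).congr' ?_)
      (tendsto_dunfordPow_add_one hT ⟨Q, hQ⟩ hz f)
    filter_upwards [self_mem_nhdsWithin] with w hw
    rw [← dunfordPow_mul_inverse hT hQ hw]
    rfl

end Powers

/-- The properties of the powers `V z = T^{-z}`, `Re z ≥ 0`, of an operator with inverse `Q` and
bounded imaginary powers which enter the interpolation argument. -/
structure IsNegPowFamily {H : Type*} [NormedAddCommGroup H] [InnerProductSpace ℂ H]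
    (Q : H →L[ℂ] H) (V : ℂ → H →L[ℂ] H) (N θ : ℝ) : Prop where
  inverse_mul : ∀ z : ℂ, 0 ≤ z.re → Q * V z = V (z + 1)
  mul_inverse : ∀ z : ℂ, 0 ≤ z.re → V z * Q = V (z + 1)
  norm_le : ∀ z : ℂ, z.re = 0 → ‖V z‖ ≤ N * Real.exp (θ * |z.im|)
  differentiableAt : ∀ z : ℂ, 0 < z.re → DifferentiableAt ℂ V z
  growth : ∃ C : ℝ, ∀ z : ℂ, z.re ∈ Set.Icc 1 2 → ‖V z‖ ≤ C * Real.exp (Real.pi * |z.im|)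

theorem HasBIP.isNegPowFamily {H : Type*} [NormedAddCommGroup H] [InnerProductSpace ℂ H]
    [CompleteSpace H] {T : H →ₗ.[ℂ] H} {N θ : ℝ} (hBIP : HasBIP T N θ) (hT : IsSectorial T)
    {Q : H →L[ℂ] H} (hQ : IsResolventAt T 0 Q) :
    IsNegPowFamily Q (boundedNegPow T) N θ where
  inverse_mul _ hz := hBIP.inverse_mul_boundedNegPow hT hQ hz
  mul_inverse _ hz := hBIP.boundedNegPow_mul_inverse hT hQ hz
  norm_le _ hz := hBIP.norm_boundedNegPow_le hz
  differentiableAt z hz := by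
    refine (differentiableAt_dunfordPow hT ⟨Q, hQ⟩ hz).congr_of_eventuallyEq ?_
    filter_upwards [(isOpen_lt continuous_const Complex.continuous_re).mem_nhds hz] with w hw
    exact boundedNegPow_of_re_pos hw
  growth := by
    obtain ⟨C, hC⟩ := exists_norm_dunfordPow_le hT ⟨Q, hQ⟩ (b := 2) one_pos
    refine ⟨C, fun z hz => ?_⟩
    rw [boundedNegPow_of_re_pos (one_pos.trans_le hz.1)]
    exact hC z hz

/-! ### Synthesis operators and a compactness criterion -/

section Synthesis

variable {ι : Type*} [Fintype ι] {E F : Type*}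
  [NormedAddCommGroup E] [InnerProductSpace ℂ E]
  [NormedAddCommGroup F] [InnerProductSpace ℂ F]

/-- The synthesis operator `c ↦ ∑ i, c i • x i` of a finite family of vectors. Its norm is the
optimal Bessel constant of the family. -/
def synthesis (x : ι → E) : EuclideanSpace ℂ ι →L[ℂ] E :=
  ∑ i, (EuclideanSpace.proj i : EuclideanSpace ℂ ι →L[ℂ] ℂ).smulRight (x i)

theorem synthesis_apply (x : ι → E) (c : EuclideanSpace ℂ ι) :
    synthesis x c = ∑ i, c i • x i := by
  simp [synthesis, sum_apply]

theorem synthesis_single [DecidableEq ι] (x : ι → E) (i : ι) :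
    synthesis x (EuclideanSpace.single i 1) = x i := by
  rw [synthesis_apply, Finset.sum_eq_single i] <;> simp +contextual

theorem continuous_synthesis : Continuous (synthesis : (ι → E) → _) := by
  unfold synthesis
  refine continuous_finsetSum _ fun i _ => ?_
  exact (ContinuousLinearMap.smulRightL ℂ (EuclideanSpace ℂ ι) E
    (EuclideanSpace.proj i)).continuous.comp (continuous_apply i)

theorem synthesis_comp (V : E →L[ℂ] F) (x : ι → E) :
    synthesis (fun i => V (x i)) = V ∘L synthesis x := by
  ext c
  simp [synthesis_apply]

theorem norm_synthesis_comp_le (V : E →L[ℂ] F) (x : ι → E) :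
    ‖synthesis (fun i => V (x i))‖ ≤ ‖V‖ * ‖synthesis x‖ := by
  rw [synthesis_comp]
  exact V.opNorm_comp_le _

theorem norm_synthesis_le_one {x : ι → E} (hx : Orthonormal ℂ x) : ‖synthesis x‖ ≤ 1 := by
  refine ContinuousLinearMap.opNorm_le_bound _ zero_le_one fun c => ?_
  rw [one_mul, synthesis_apply, ← sq_le_sq₀ (norm_nonneg _) (norm_nonneg _),
    EuclideanSpace.norm_sq_eq, @norm_sq_eq_re_inner ℂ, hx.inner_sum]
  simp [Complex.conj_mul', ← Complex.ofReal_pow]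

theorem norm_le_norm_synthesis (x : ι → E) (i : ι) : ‖x i‖ ≤ ‖synthesis x‖ := by
  classical
  simpa only [synthesis_single, PiLp.norm_single, norm_one, mul_one] using
    (synthesis x).le_opNorm (EuclideanSpace.single i 1)

theorem norm_synthesis_const_le [Unique ι] (x : E) : ‖synthesis fun _ : ι => x‖ ≤ ‖x‖ := by
  refine ContinuousLinearMap.opNorm_le_bound _ (norm_nonneg _) fun c => ?_
  rw [synthesis_apply]
  simp [norm_smul, EuclideanSpace.norm_eq, mul_comm]

theorem sum_norm_inner_sq_le [CompleteSpace E] (x : ι → E) (u : E) :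
    ∑ i, ‖inner ℂ (x i) u‖ ^ 2 ≤ (‖synthesis x‖ * ‖u‖) ^ 2 := by
  classical
  have hcoord : ∀ i, inner ℂ (x i) u = (synthesis x).adjoint u i := fun i => by
    conv_lhs => rw [← synthesis_single x i]
    rw [← ContinuousLinearMap.adjoint_inner_right, EuclideanSpace.inner_single_left]
    simp
  simp_rw [hcoord]
  rw [← EuclideanSpace.norm_sq_eq, ← LinearIsometryEquiv.norm_map ContinuousLinearMap.adjoint]
  gcongr
  exact ContinuousLinearMap.le_opNorm _ _

end Synthesis

section Compactness

variable {E F : Type*} [NormedAddCommGroup E] [InnerProductSpace ℂ E]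
  [NormedAddCommGroup F] [InnerProductSpace ℂ F] {p M ε : ℝ}

theorem isCompactOperator_starProjection (K : Submodule ℂ E) [FiniteDimensional ℂ K] :
    IsCompactOperator K.starProjection := by
  have : ProperSpace K := FiniteDimensional.proper ℂ K
  have h : IsCompactOperator K.orthogonalProjectionOnto :=
    isCompactOperator_of_locallyCompactSpace_dom _
  exact h.clm_comp K.subtypeL

theorem isCompactOperator_sub_compression_orthogonal (B : E →L[ℂ] F) (U : Submodule ℂ E)
    (W : Submodule ℂ F) [FiniteDimensional ℂ U] [FiniteDimensional ℂ W] :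
    IsCompactOperator (B - Wᗮ.starProjection ∘L B ∘L Uᗮ.starProjection : E →L[ℂ] F) := by
  have hsplit : B - Wᗮ.starProjection ∘L B ∘L Uᗮ.starProjection
      = W.starProjection ∘L B + Wᗮ.starProjection ∘L B ∘L U.starProjection := by
    ext e
    simp only [sub_apply, add_apply, ContinuousLinearMap.comp_apply,
      Submodule.starProjection_orthogonal_val, map_sub]
    abel
  rw [hsplit]
  exact ((isCompactOperator_starProjection W).comp_clm B).add
    (((isCompactOperator_starProjection U).clm_comp B).clm_comp Wᗮ.starProjection)

theorem norm_compression_le (hε : 0 ≤ ε) {B : E →L[ℂ] F} (K : Submodule ℂ E)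
    (L : Submodule ℂ F) [K.HasOrthogonalProjection] [L.HasOrthogonalProjection]
    (h : ∀ e ∈ K, ∀ f ∈ L, ‖e‖ = 1 → ‖f‖ = 1 → ‖inner ℂ f (B e)‖ ≤ ε) :
    ‖L.starProjection ∘L B ∘L K.starProjection‖ ≤ ε := by
  set D : K →L[ℂ] L := L.orthogonalProjectionOnto ∘L B ∘L K.subtypeL
  have hD : ‖D‖ ≤ ε := by
    refine ContinuousLinearMap.opNorm_le_of_re_inner_le hε fun e f he hf => ?_
    refine (Complex.re_le_norm _).trans ?_
    rw [norm_inner_symm]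
    simpa [D] using h e e.2 f f.2 he hf
  calc ‖L.subtypeL ∘L D ∘L K.orthogonalProjectionOnto‖
      ≤ ‖L.subtypeL‖ * (‖D‖ * ‖K.orthogonalProjectionOnto‖) :=
        (ContinuousLinearMap.opNorm_comp_le _ _).trans
          (by gcongr; exact ContinuousLinearMap.opNorm_comp_le _ _)
    _ ≤ 1 * (ε * 1) := by
        gcongr
        · exact L.norm_subtypeL_le
        · exact K.orthogonalProjectionOnto_norm_le
    _ = ε := by ring

theorem exists_maximal_orthonormal_pair (hp : 0 < p) (hε : 0 < ε) {B : E →L[ℂ] F}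
    (hB : ∀ (n : ℕ) (x : Fin n → E) (y : Fin n → F), Orthonormal ℂ x → Orthonormal ℂ y →
      ∑ i, ‖inner ℂ (y i) (B (x i))‖ ^ p ≤ M) :
    ∃ (n : ℕ) (x : Fin n → E) (y : Fin n → F), ∀ e f, (∀ i, inner ℂ e (x i) = 0) →
      (∀ i, inner ℂ f (y i) = 0) → ‖e‖ = 1 → ‖f‖ = 1 → ‖inner ℂ f (B e)‖ < ε := by
  by_contra! hext
  have hall : ∀ n : ℕ, ∃ (x : Fin n → E) (y : Fin n → F), Orthonormal ℂ x ∧ Orthonormal ℂ y ∧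
      ∀ i, ε ≤ ‖inner ℂ (y i) (B (x i))‖ := fun n => by
    induction n with
    | zero => exact ⟨Fin.elim0, Fin.elim0, .of_isEmpty _, .of_isEmpty _, fun i => i.elim0⟩
    | succ n ih =>
      obtain ⟨x, y, hx, hy, hxy⟩ := ih
      obtain ⟨e, f, hex, hfy, he, hf, hef⟩ := hext n x y
      exact ⟨Matrix.vecCons e x, Matrix.vecCons f y, orthonormal_vecCons_iff.2 ⟨he, hex, hx⟩,
        orthonormal_vecCons_iff.2 ⟨hf, hfy, hy⟩, Fin.forall_fin_succ.2 ⟨hef, hxy⟩⟩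
  obtain ⟨n, hn⟩ := exists_nat_gt (M / ε ^ p)
  obtain ⟨x, y, hx, hy, hxy⟩ := hall n
  have hle : ∑ _i : Fin n, ε ^ p ≤ M :=
    (Finset.sum_le_sum fun i _ => Real.rpow_le_rpow hε.le (hxy i) hp.le).trans (hB n x y hx hy)
  rw [Finset.sum_const, Finset.card_univ, Fintype.card_fin, nsmul_eq_mul] at hle
  rw [div_lt_iff₀ (by positivity)] at hn
  exact hn.not_ge hle

theorem isCompactOperator_of_sum_norm_inner_rpow_le [CompleteSpace F] (hp : 0 < p)
    {B : E →L[ℂ] F}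
    (hB : ∀ (n : ℕ) (x : Fin n → E) (y : Fin n → F), Orthonormal ℂ x → Orthonormal ℂ y →
      ∑ i, ‖inner ℂ (y i) (B (x i))‖ ^ p ≤ M) : IsCompactOperator B := by
  have hcl : IsClosed {f : E →L[ℂ] F | IsCompactOperator f} := isClosed_setOfPred_isCompactOperator
  refine hcl.closure_subset (Metric.mem_closure_iff.2 fun ε' hε' => ?_)
  obtain ⟨ε, hε, hεε'⟩ := exists_between hε'
  obtain ⟨n, x, y, hxy⟩ := exists_maximal_orthonormal_pair hp hε hB
  set U : Submodule ℂ E := Submodule.span ℂ (Set.range x)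
  set W : Submodule ℂ F := Submodule.span ℂ (Set.range y)
  have : FiniteDimensional ℂ U := FiniteDimensional.span_of_finite ℂ (Set.finite_range x)
  have : FiniteDimensional ℂ W := FiniteDimensional.span_of_finite ℂ (Set.finite_range y)
  refine ⟨_, isCompactOperator_sub_compression_orthogonal B U W, ?_⟩
  rw [dist_eq_norm, sub_sub_cancel]
  refine (norm_compression_le hε.le Uᗮ Wᗮ fun e he f hf he₁ hf₁ => ?_).trans_lt hεε'
  have hx : ∀ i, x i ∈ U := fun i => Submodule.subset_span (Set.mem_range_self i)
  have hy : ∀ i, y i ∈ W := fun i => Submodule.subset_span (Set.mem_range_self i)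
  exact (hxy e f (fun i => Submodule.inner_left_of_mem_orthogonal (hx i) he)
    (fun i => Submodule.inner_left_of_mem_orthogonal (hy i) hf) he₁ hf₁).le

end Compactness

/-! ### Schatten classes -/

section SchurTest

variable {ι κ : Type*} [Fintype ι] [Fintype κ] {p K : ℝ}

theorem sum_mul_le_of_sum_sq_le {X Y : ℝ} (hX : 0 ≤ X) (hY : 0 ≤ Y) {f g : ι → ℝ}
    (hf : ∑ j, f j ^ 2 ≤ X ^ 2) (hg : ∑ j, g j ^ 2 ≤ Y ^ 2) : ∑ j, f j * g j ≤ X * Y :=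
  (Real.sum_mul_le_sqrt_mul_sqrt Finset.univ f g).trans <|
    mul_le_mul (Real.sqrt_le_iff.2 ⟨hX, hf⟩) (Real.sqrt_le_iff.2 ⟨hY, hg⟩) (Real.sqrt_nonneg _) hX

theorem rpow_sum_mul_le (hp : 1 ≤ p) {a s : κ → ℝ} (ha : ∀ n, 0 ≤ a n) (hs : ∀ n, 0 ≤ s n) :
    (∑ n, a n * s n) ^ p ≤ (∑ n, a n) ^ (p - 1) * ∑ n, a n * s n ^ p := by
  have hp₀ : 0 < p := by linarith
  have ha' : 0 ≤ ∑ n, a n := Finset.sum_nonneg fun n _ => ha n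
  have has : 0 ≤ ∑ n, a n * s n ^ p :=
    Finset.sum_nonneg fun n _ => mul_nonneg (ha n) (Real.rpow_nonneg (hs n) _)
  have hHolder := Real.inner_le_weight_mul_Lp_of_nonneg Finset.univ hp a s ha hs
  have hpow := Real.rpow_le_rpow (Finset.sum_nonneg fun n _ => mul_nonneg (ha n) (hs n))
    hHolder hp₀.le
  rwa [Real.mul_rpow (Real.rpow_nonneg ha' _) (Real.rpow_nonneg has _), ← Real.rpow_mul ha',
    ← Real.rpow_mul has, sub_mul, one_mul, inv_mul_cancel₀ hp₀.ne', Real.rpow_one] at hpow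

theorem sum_rpow_sum_mul_le (hp : 1 ≤ p) (hK : 0 ≤ K) {a : ι → κ → ℝ} {s : κ → ℝ}
    (ha : ∀ i n, 0 ≤ a i n) (hrow : ∀ i, ∑ n, a i n ≤ K) (hcol : ∀ n, ∑ i, a i n ≤ K)
    (hs : ∀ n, 0 ≤ s n) : ∑ i, (∑ n, a i n * s n) ^ p ≤ K ^ p * ∑ n, s n ^ p := by
  have hsp : ∀ n, 0 ≤ s n ^ p := fun n => Real.rpow_nonneg (hs n) p
  calc ∑ i, (∑ n, a i n * s n) ^ p
      ≤ ∑ i, (∑ n, a i n) ^ (p - 1) * ∑ n, a i n * s n ^ p :=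
        Finset.sum_le_sum fun i _ => rpow_sum_mul_le hp (ha i) hs
    _ ≤ ∑ i, K ^ (p - 1) * ∑ n, a i n * s n ^ p := by
        gcongr with i
        · exact Finset.sum_nonneg fun n _ => mul_nonneg (ha i n) (hsp n)
        · exact Finset.sum_nonneg fun n _ => ha i n
        · exact hrow i
    _ = K ^ (p - 1) * ∑ n, (∑ i, a i n) * s n ^ p := by
        rw [← Finset.mul_sum, Finset.sum_comm]
        simp_rw [Finset.sum_mul]
    _ ≤ K ^ (p - 1) * ∑ n, K * s n ^ p := by
        gcongr with n
        · exact hsp n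
        · exact hcol n
    _ = K ^ p * ∑ n, s n ^ p := by
        rw [← Finset.mul_sum, ← mul_assoc, ← Real.rpow_add_one' hK (by linarith), sub_add_cancel]

end SchurTest

theorem sum_norm_inner_mul_norm_inner_le {κ E F : Type*} [Fintype κ]
    [NormedAddCommGroup E] [InnerProductSpace ℂ E] [NormedAddCommGroup F] [InnerProductSpace ℂ F]
    {u : κ → E} {v : κ → F} (hu : Orthonormal ℂ u)
    (hv : Orthonormal ℂ v) (x : E) (y : F) :
    ∑ n, ‖inner ℂ (u n) x‖ * ‖inner ℂ (v n) y‖ ≤ ‖x‖ * ‖y‖ :=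
  sum_mul_le_of_sum_sq_le (norm_nonneg _) (norm_nonneg _)
    (hu.sum_inner_products_le _) (hv.sum_inner_products_le _)

section Schatten

variable {ι κ E F : Type*} {p : ℝ}
  [NormedAddCommGroup E] [InnerProductSpace ℂ E] [CompleteSpace E]
  [NormedAddCommGroup F] [InnerProductSpace ℂ F] [CompleteSpace F]
  {A : E →L[ℂ] F}

theorem sum_norm_inner_rpow_le_of_singular_expansion [Fintype ι] [Fintype κ] (hp : 1 ≤ p)
    {u : κ → E} {v : κ → F} (hu : Orthonormal ℂ u) (hv : Orthonormal ℂ v) {s : κ → ℝ}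
    (hs : ∀ n, 0 ≤ s n) {x : ι → E}
    (hA : ∀ i, A (x i) = ∑ n, ((s n : ℂ) * inner ℂ (u n) (x i)) • v n) (y : ι → F) :
    ∑ i, ‖inner ℂ (y i) (A (x i))‖ ^ p
      ≤ (‖synthesis x‖ * ‖synthesis y‖) ^ p * ∑ n, s n ^ p := by
  set a : ι → κ → ℝ := fun i n => ‖inner ℂ (u n) (x i)‖ * ‖inner ℂ (v n) (y i)‖
  have hrow : ∀ i, ∑ n, a i n ≤ ‖synthesis x‖ * ‖synthesis y‖ := fun i =>
    (sum_norm_inner_mul_norm_inner_le hu hv _ _).trans <|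
      mul_le_mul (norm_le_norm_synthesis x i) (norm_le_norm_synthesis y i)
        (norm_nonneg _) (norm_nonneg _)
  have hcol : ∀ n, ∑ i, a i n ≤ ‖synthesis x‖ * ‖synthesis y‖ := fun n => by
    refine sum_mul_le_of_sum_sq_le (norm_nonneg _) (norm_nonneg _) ?_ ?_
    · simpa only [norm_inner_symm (u n), hu.1 n, mul_one] using sum_norm_inner_sq_le x (u n)
    · simpa only [norm_inner_symm (v n), hv.1 n, mul_one] using sum_norm_inner_sq_le y (v n)
  have hentry : ∀ i, ‖inner ℂ (y i) (A (x i))‖ ≤ ∑ n, a i n * s n := fun i => by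
    rw [hA i, inner_sum]
    refine (norm_sum_le _ _).trans (Finset.sum_le_sum fun n _ => le_of_eq ?_)
    rw [inner_smul_right, norm_mul, norm_mul, Complex.norm_of_nonneg (hs n),
      norm_inner_symm (y i)]
    ring
  exact (Finset.sum_le_sum fun i _ => Real.rpow_le_rpow (norm_nonneg _) (hentry i)
    (by linarith)).trans (sum_rpow_sum_mul_le hp (by positivity)
      (fun i n => by positivity) hrow hcol hs)

theorem isSymmetric_adjoint_comp_self (A : E →L[ℂ] F) :
    ((A.adjoint ∘L A : E →L[ℂ] E) : E →ₗ[ℂ] E).IsSymmetric := fun x y => by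
  simp [ContinuousLinearMap.adjoint_inner_left, ContinuousLinearMap.adjoint_inner_right]

/-- The eigenspace of `A* A` for the eigenvalue `t²`; its nonzero vectors are the right singular
vectors of `A` for the singular value `t`. -/
abbrev singularSpace (A : E →L[ℂ] F) (t : ℝ) : Submodule ℂ E :=
  Module.End.eigenspace
    ((ContinuousLinearMap.adjoint A ∘L A : E →L[ℂ] E) : E →ₗ[ℂ] E) ((t ^ 2 : ℝ) : ℂ)

theorem adjoint_apply_of_mem_singularSpace {t : ℝ} {x : E} (hx : x ∈ singularSpace A t) :
    A.adjoint (A x) = ((t ^ 2 : ℝ) : ℂ) • x :=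
  Module.End.mem_eigenspace_iff.1 hx

theorem inner_apply_apply_of_mem_singularSpace {t : ℝ} {y : E} (hy : y ∈ singularSpace A t)
    (x : E) : inner ℂ (A x) (A y) = ((t ^ 2 : ℝ) : ℂ) * inner ℂ x y := by
  rw [← ContinuousLinearMap.adjoint_inner_right, adjoint_apply_of_mem_singularSpace hy,
    inner_smul_right]

theorem orthogonalFamily_singularSpace (A : E →L[ℂ] F) :
    OrthogonalFamily ℂ (fun t : Set.Ioi (0 : ℝ) => singularSpace A t)
      fun t => (singularSpace A t).subtypeₗᵢ := by
  refine (isSymmetric_adjoint_comp_self A).orthogonalFamily_eigenspaces.comp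
    (f := fun t : Set.Ioi (0 : ℝ) => (((t : ℝ) ^ 2 : ℝ) : ℂ)) fun s t h => ?_
  have hs : (0 : ℝ) < s := s.2
  have ht : (0 : ℝ) < t := t.2
  exact Subtype.ext ((sq_eq_sq₀ hs.le ht.le).1 (Complex.ofReal_injective h))

theorem finiteDimensional_singularSpace (hA : IsCompactOperator A) {t : ℝ} (ht : t ≠ 0) :
    FiniteDimensional ℂ (singularSpace A t) :=
  ContinuousLinearMap.finite_dimensional_eigenspace
    (show IsCompactOperator (A.adjoint ∘L A : E →L[ℂ] E) from hA.clm_comp A.adjoint) _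
    (by exact_mod_cast pow_ne_zero 2 ht)

theorem exists_singular_system (hA : IsCompactOperator A) (τ : Finset (Set.Ioi (0 : ℝ))) :
    ∃ u : (Σ t : τ, Fin (singularMultiplicity A t)) → E, Orthonormal ℂ u ∧
      (∀ n, u n ∈ singularSpace A n.1) ∧
      ∀ t ∈ τ, ∀ x ∈ singularSpace A t, ∑ n, inner ℂ (u n) x • u n = x := by
  have hfam : OrthogonalFamily ℂ (fun t : τ => singularSpace A t)
      fun t => (singularSpace A t).subtypeₗᵢ :=
    (orthogonalFamily_singularSpace A).comp Subtype.val_injective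
  have hfin : ∀ t : τ, FiniteDimensional ℂ (singularSpace A t) := fun t =>
    finiteDimensional_singularSpace hA (ne_of_gt t.1.2)
  let b : ∀ t : τ, OrthonormalBasis (Fin (singularMultiplicity A t)) ℂ (singularSpace A t) :=
    fun t => stdOrthonormalBasis ℂ (singularSpace A t)
  refine ⟨fun n => (b n.1 n.2 : E),
    hfam.orthonormal_sigma_orthonormal (v_family := fun t j => b t j) fun t => (b t).orthonormal,
    fun n => (b n.1 n.2).2, fun t ht x hx => ?_⟩
  rw [Fintype.sum_sigma, Finset.sum_eq_single ⟨t, ht⟩]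
  · have hexp := congrArg (singularSpace A t).subtype ((b ⟨t, ht⟩).sum_repr ⟨x, hx⟩)
    simpa [OrthonormalBasis.repr_apply_apply] using hexp
  · intro s _ hs
    refine Finset.sum_eq_zero fun j _ => ?_
    have horth : inner ℂ (b s j : E) x = 0 :=
      hfam hs (b s j) (⟨x, hx⟩ : singularSpace A (⟨t, ht⟩ : τ))
    rw [horth, zero_smul]
  · simp

theorem orthonormal_left_singular {u : κ → E} (hu : Orthonormal ℂ u) {s : κ → ℝ}
    (hs : ∀ n, 0 < s n) (hus : ∀ n, u n ∈ singularSpace A (s n)) :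
    Orthonormal ℂ (fun n => ((s n : ℂ)⁻¹) • A (u n)) := by
  classical
  rw [orthonormal_iff_ite] at hu ⊢
  intro i j
  have hj : (s j : ℂ) ≠ 0 := by exact_mod_cast (hs j).ne'
  rw [inner_smul_left, inner_smul_right, inner_apply_apply_of_mem_singularSpace (hus j), hu i j]
  split_ifs with h
  · subst h
    simp only [map_inv₀, Complex.conj_ofReal, Complex.ofReal_pow]
    field_simp
  · simp

theorem inner_left_singular {u : E} (hu : ‖u‖ = 1) {s : ℝ} (hus : u ∈ singularSpace A s) :
    inner ℂ ((s : ℂ)⁻¹ • A u) (A u) = s := by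
  rw [inner_smul_left, inner_apply_apply_of_mem_singularSpace hus, inner_self_eq_norm_sq_to_K, hu]
  rcases eq_or_ne s 0 with rfl | hs
  · simp
  · have hs' : (s : ℂ) ≠ 0 := by exact_mod_cast hs
    simp only [map_inv₀, Complex.conj_ofReal, Complex.ofReal_pow]
    simp [field]

theorem eigenvalue_adjoint_comp_self_eq {μ : ℂ} {w : E} (hw : A.adjoint (A w) = μ • w)
    (hw₀ : w ≠ 0) : μ = (((‖A w‖ / ‖w‖) ^ 2 : ℝ) : ℂ) := by
  have hwn : (‖w‖ : ℂ) ≠ 0 := by exact_mod_cast norm_ne_zero_iff.2 hw₀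
  have hinner : inner ℂ w (A.adjoint (A w)) = inner ℂ (A w) (A w) :=
    ContinuousLinearMap.adjoint_inner_right _ _ _
  rw [hw, inner_smul_right, inner_self_eq_norm_sq_to_K, inner_self_eq_norm_sq_to_K] at hinner
  push_cast
  rw [div_pow, eq_div_iff (pow_ne_zero 2 hwn)]
  exact hinner

theorem inner_eq_zero_of_apply_eq_zero {t : ℝ} (ht : t ≠ 0) {u w : E}
    (hu : u ∈ singularSpace A t) (hw : A w = 0) : inner ℂ u w = 0 := by
  have h := inner_apply_apply_of_mem_singularSpace hu w
  rw [hw, inner_zero_left, eq_comm, mul_eq_zero] at h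
  exact inner_eq_zero_symm.1 (h.resolve_left (by exact_mod_cast pow_ne_zero 2 ht))

theorem exists_singular_expansion [Finite ι] (hA : IsCompactOperator A) {x : ι → E}
    (hx : ∀ i, x i ∈ ⨆ μ, Module.End.eigenspace
      ((ContinuousLinearMap.adjoint A ∘L A : E →L[ℂ] E) : E →ₗ[ℂ] E) μ) :
    ∃ (τ : Finset (Set.Ioi (0 : ℝ))) (u : (Σ t : τ, Fin (singularMultiplicity A t)) → E),
      Orthonormal ℂ u ∧ (∀ n, u n ∈ singularSpace A n.1) ∧
      ∀ i, A (x i) = ∑ n, inner ℂ (u n) (x i) • A (u n) := by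
  classical
  have := Fintype.ofFinite ι
  choose M hM using fun i => Submodule.mem_iSup_iff_exists_finset.1 (hx i)
  set τ : Finset (Set.Ioi (0 : ℝ)) :=
    ((Finset.univ.biUnion M).image fun μ => Real.sqrt μ.re).subtype (· ∈ Set.Ioi (0 : ℝ)) with hτ
  obtain ⟨u, hu, hus, hsum⟩ := exists_singular_system hA τ
  refine ⟨τ, u, hu, hus, fun i => ?_⟩
  set L : E →ₗ[ℂ] F := ∑ n, (innerSL ℂ (u n) : E →ₗ[ℂ] ℂ).smulRight (A (u n)) with hL
  have hL_apply : ∀ w, L w = ∑ n, inner ℂ (u n) w • A (u n) := fun w => by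
    simp [hL, LinearMap.sum_apply]
  suffices h : ∀ μ ∈ M i, Module.End.eigenspace
      ((ContinuousLinearMap.adjoint A ∘L A : E →L[ℂ] E) : E →ₗ[ℂ] E) μ
      ≤ LinearMap.eqLocus (A : E →ₗ[ℂ] F) L from
    (LinearMap.mem_eqLocus.1 (iSup₂_le h (hM i))).trans (hL_apply _)
  refine fun μ hμ w hw => LinearMap.mem_eqLocus.2 ?_
  rw [ContinuousLinearMap.coe_coe, hL_apply]
  rcases eq_or_ne (A w) 0 with hAw | hAw
  · rw [hAw]
    refine (Finset.sum_eq_zero fun n _ => ?_).symm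
    rw [inner_eq_zero_of_apply_eq_zero (ne_of_gt n.1.1.2) (hus n) hAw, zero_smul]
  · have hw₀ : w ≠ 0 := fun h => hAw (by rw [h, map_zero])
    have hpos : 0 < ‖A w‖ / ‖w‖ := div_pos (norm_pos_iff.2 hAw) (norm_pos_iff.2 hw₀)
    have hAAw : A.adjoint (A w) = μ • w := Module.End.mem_eigenspace_iff.1 hw
    have hμt := eigenvalue_adjoint_comp_self_eq hAAw hw₀
    have hτ_mem : (⟨‖A w‖ / ‖w‖, hpos⟩ : Set.Ioi (0 : ℝ)) ∈ τ := by
      rw [hτ, Finset.mem_subtype, Finset.mem_image]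
      refine ⟨μ, Finset.mem_biUnion.2 ⟨i, Finset.mem_univ _, hμ⟩, ?_⟩
      rw [hμt, Complex.ofReal_re, Real.sqrt_sq hpos.le]
    have hmem : w ∈ singularSpace A (‖A w‖ / ‖w‖) := by rwa [singularSpace, ← hμt]
    have hexp := congrArg A (hsum _ hτ_mem w hmem)
    simpa only [map_sum, map_smul] using hexp.symm

theorem singularMultiplicity_mul_rpow_nonneg (A : E →L[ℂ] F) (p : ℝ) (t : Set.Ioi (0 : ℝ)) :
    0 ≤ (singularMultiplicity A t : ℝ) * (t : ℝ) ^ p :=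
  mul_nonneg (Nat.cast_nonneg _) (Real.rpow_nonneg (le_of_lt t.2) _)

theorem sum_sigma_singularMultiplicity (A : E →L[ℂ] F) (p : ℝ) (τ : Finset (Set.Ioi (0 : ℝ))) :
    ∑ n : (Σ t : τ, Fin (singularMultiplicity A t)), (n.1 : ℝ) ^ p
      = ∑ t ∈ τ, (singularMultiplicity A t : ℝ) * (t : ℝ) ^ p := by
  rw [Fintype.sum_sigma,
    ← Finset.sum_coe_sort τ fun t => (singularMultiplicity A t : ℝ) * (t : ℝ) ^ p]
  simp

theorem schattenNorm_nonneg (p : ℝ) (A : E →L[ℂ] F) : 0 ≤ schattenNorm p A :=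
  Real.rpow_nonneg (tsum_nonneg (singularMultiplicity_mul_rpow_nonneg A p)) _

theorem schattenNorm_rpow (hp : p ≠ 0) (A : E →L[ℂ] F) :
    schattenNorm p A ^ p
      = ∑' t : Set.Ioi (0 : ℝ), (singularMultiplicity A t : ℝ) * (t : ℝ) ^ p := by
  rw [schattenNorm, ← Real.rpow_mul (tsum_nonneg (singularMultiplicity_mul_rpow_nonneg A p)),
    one_div, inv_mul_cancel₀ hp, Real.rpow_one]

theorem MemSchatten.sum_norm_inner_rpow_le_of_mem_iSup_eigenspace [Fintype ι] (hp : 1 ≤ p)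
    (hA : MemSchatten p A) {x : ι → E}
    (hx : ∀ i, x i ∈ ⨆ μ, Module.End.eigenspace
      ((ContinuousLinearMap.adjoint A ∘L A : E →L[ℂ] E) : E →ₗ[ℂ] E) μ) (y : ι → F) :
    ∑ i, ‖inner ℂ (y i) (A (x i))‖ ^ p
      ≤ (‖synthesis x‖ * ‖synthesis y‖ * schattenNorm p A) ^ p := by
  obtain ⟨τ, u, hu, hus, hexp⟩ := exists_singular_expansion hA.1 hx
  have hpos : ∀ n : (Σ t : τ, Fin (singularMultiplicity A t)), (0 : ℝ) < n.1 := fun n => n.1.1.2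
  have hexp' : ∀ i, A (x i)
      = ∑ n, (((n.1 : ℝ) : ℂ) * inner ℂ (u n) (x i)) • ((n.1 : ℝ) : ℂ)⁻¹ • A (u n) := fun i => by
    rw [hexp i]
    refine Finset.sum_congr rfl fun n _ => ?_
    have hn : ((n.1 : ℝ) : ℂ) ≠ 0 := by exact_mod_cast (hpos n).ne'
    rw [smul_smul, mul_right_comm, mul_inv_cancel₀ hn, one_mul]
  refine (sum_norm_inner_rpow_le_of_singular_expansion hp hu
    (orthonormal_left_singular hu hpos hus) (fun n => (hpos n).le) hexp' y).trans ?_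
  rw [Real.mul_rpow (by positivity) (schattenNorm_nonneg p A), schattenNorm_rpow (by linarith),
    sum_sigma_singularMultiplicity]
  gcongr
  exact hA.2.sum_le_tsum τ fun t _ => singularMultiplicity_mul_rpow_nonneg A p t

theorem MemSchatten.sum_norm_inner_rpow_le [Fintype ι] (hp : 1 ≤ p) (hA : MemSchatten p A)
    (x : ι → E) (y : ι → F) :
    ∑ i, ‖inner ℂ (y i) (A (x i))‖ ^ p
      ≤ (‖synthesis x‖ * ‖synthesis y‖ * schattenNorm p A) ^ p := by
  have hp₀ : 0 ≤ p := by linarith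
  set D : Submodule ℂ E := ⨆ μ, Module.End.eigenspace
      ((ContinuousLinearMap.adjoint A ∘L A : E →L[ℂ] E) : E →ₗ[ℂ] E) μ
  have hdense : Dense (D : Set E) := by
    rw [Submodule.dense_iff_topologicalClosure_eq_top, Submodule.topologicalClosure_eq_top_iff]
    exact ContinuousLinearMap.orthogonalComplement_iSup_eigenspaces_eq_bot
      (hA.1.clm_comp A.adjoint) (isSymmetric_adjoint_comp_self A)
  have hclosed : IsClosed {x : ι → E | ∑ i, ‖inner ℂ (y i) (A (x i))‖ ^ p
      ≤ (‖synthesis x‖ * ‖synthesis y‖ * schattenNorm p A) ^ p} := by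
    have := continuous_synthesis (ι := ι) (E := E)
    exact isClosed_le
      (continuous_finsetSum _ fun i _ => Continuous.rpow_const (by fun_prop) fun _ => .inr hp₀)
      (Continuous.rpow_const (by fun_prop) fun _ => .inr hp₀)
  refine hclosed.closure_subset_iff.2 (fun x hx => ?_)
    (dense_pi (Set.univ : Set ι) (s := fun _ => (D : Set E)) (fun i _ => hdense) x)
  exact hA.sum_norm_inner_rpow_le_of_mem_iSup_eigenspace hp (fun i => hx i (Set.mem_univ i)) y

theorem sum_singularMultiplicity_mul_rpow_le {M : ℝ} (hA : IsCompactOperator A)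
    (hM : ∀ (n : ℕ) (x : Fin n → E) (y : Fin n → F), Orthonormal ℂ x → Orthonormal ℂ y →
      ∑ i, ‖inner ℂ (y i) (A (x i))‖ ^ p ≤ M) (τ : Finset (Set.Ioi (0 : ℝ))) :
    ∑ t ∈ τ, (singularMultiplicity A t : ℝ) * (t : ℝ) ^ p ≤ M := by
  obtain ⟨u, hu, hus, -⟩ := exists_singular_system hA τ
  have hpos : ∀ n : (Σ t : τ, Fin (singularMultiplicity A t)), (0 : ℝ) < n.1 := fun n => n.1.1.2
  have hv := orthonormal_left_singular hu hpos hus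
  let e := (Fintype.equivFin (Σ t : τ, Fin (singularMultiplicity A t))).symm
  rw [← sum_sigma_singularMultiplicity, ← e.sum_comp]
  refine (Finset.sum_congr rfl fun i _ => ?_).trans_le
    (hM _ (u ∘ e) _ (hu.comp e e.injective) (hv.comp e e.injective))
  simp only [Function.comp_apply]
  rw [inner_left_singular (hu.1 _) (hus _), Complex.norm_of_nonneg (hpos _).le]

theorem memSchatten_of_sum_norm_inner_rpow_le {M : ℝ} (hp : 0 < p) (hM : 0 ≤ M)
    (hA : ∀ (n : ℕ) (x : Fin n → E) (y : Fin n → F), Orthonormal ℂ x → Orthonormal ℂ y →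
      ∑ i, ‖inner ℂ (y i) (A (x i))‖ ^ p ≤ M ^ p) :
    MemSchatten p A ∧ schattenNorm p A ≤ M := by
  have hcomp := isCompactOperator_of_sum_norm_inner_rpow_le hp hA
  have hnonneg := singularMultiplicity_mul_rpow_nonneg A p
  have hfin := sum_singularMultiplicity_mul_rpow_le hcomp hA
  have hsum := summable_of_sum_le hnonneg hfin
  refine ⟨⟨hcomp, hsum⟩, ?_⟩
  rw [← Real.rpow_le_rpow_iff (schattenNorm_nonneg p A) hM hp, schattenNorm_rpow hp.ne']
  exact hsum.tsum_le_of_sum_le hfin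

end Schatten

/-! ### The three lines theorem with exponential growth -/

section ThreeLines

theorem mul_sub_mul_sq_le {k : ℝ} (hk : 0 < k) (c y : ℝ) :
    c * |y| - k * y ^ 2 ≤ (4 * k)⁻¹ * c ^ 2 := by
  have hsq : (4 * k)⁻¹ * c ^ 2 - (c * |y| - k * y ^ 2) = (4 * k)⁻¹ * (c - 2 * k * |y|) ^ 2 := by
    rw [← sq_abs y]
    field_simp
    ring
  have : 0 ≤ (4 * k)⁻¹ * (c - 2 * k * |y|) ^ 2 := by positivity
  linarith

theorem norm_exp_mul_sq_sub (k : ℝ) (z : ℂ) :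
    ‖Complex.exp (k * (z ^ 2 - z))‖ = Real.exp (-(k * z.im ^ 2 + k * z.re * (1 - z.re))) := by
  rw [Complex.norm_exp]
  congr 1
  simp only [pow_two, Complex.mul_re, Complex.sub_re, Complex.sub_im, Complex.ofReal_re,
    Complex.ofReal_im, zero_mul, sub_zero]
  ring

theorem norm_exp_mul_sq_sub_mul_le {k : ℝ} (hk : 0 < k) {z : ℂ} (hz : z.re ∈ Set.Icc 0 1)
    {a : ℝ} (ha : 0 ≤ a) (θ : ℝ) :
    ‖Complex.exp (k * (z ^ 2 - z))‖ * (a * Real.exp (θ * |z.im|))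
      ≤ Real.exp ((4 * k)⁻¹ * θ ^ 2) * a := by
  have hre : 0 ≤ k * z.re * (1 - z.re) :=
    mul_nonneg (mul_nonneg hk.le hz.1) (sub_nonneg.2 hz.2)
  have him := mul_sub_mul_sq_le hk θ z.im
  rw [norm_exp_mul_sq_sub, mul_left_comm, ← Real.exp_add, mul_comm]
  gcongr
  linarith

variable {X : Type*} [NormedAddCommGroup X] [NormedSpace ℂ X] {f : ℂ → X} {a b c C k θ : ℝ}

theorem norm_le_of_three_lines (hd : ∀ z, z.re ∈ Set.Icc 0 1 → DifferentiableAt ℂ f z)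
    (hgrowth : ∀ z, z.re ∈ Set.Icc 0 1 → ‖f z‖ ≤ C * Real.exp (c * |z.im|))
    (ha₀ : 0 ≤ a) (hb₀ : 0 ≤ b) (ha : ∀ z, z.re = 0 → ‖f z‖ ≤ a * Real.exp (θ * |z.im|))
    (hb : ∀ z, z.re = 1 → ‖f z‖ ≤ b * Real.exp (θ * |z.im|)) (hk : 0 < k) {z : ℂ}
    (hz : z.re ∈ Set.Icc 0 1) :
    ‖f z‖ ≤ Real.exp (k * z.im ^ 2 + k * z.re * (1 - z.re) + (4 * k)⁻¹ * θ ^ 2)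
      * (a ^ (1 - z.re) * b ^ z.re) := by
  -- The multiplier absorbs the growth of `f`, and its inverse is the quadratic exponential factor.
  set g : ℂ → X := fun w => Complex.exp (k * (w ^ 2 - w)) • f w
  have hg_le : ∀ (w : ℂ) (t η : ℝ), 0 ≤ t → w.re ∈ Set.Icc 0 1 →
      ‖f w‖ ≤ t * Real.exp (η * |w.im|) → ‖g w‖ ≤ Real.exp ((4 * k)⁻¹ * η ^ 2) * t :=
    fun w t η ht hw h => by
      refine le_trans ?_ (norm_exp_mul_sq_sub_mul_le hk hw ht η)
      rw [norm_smul]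
      gcongr
  have hC : 0 ≤ C := nonneg_of_mul_nonneg_left
    ((norm_nonneg _).trans (hgrowth z hz)) (Real.exp_pos _)
  have hsub : closure (Complex.HadamardThreeLines.verticalStrip 0 1)
      ⊆ Complex.HadamardThreeLines.verticalClosedStrip 0 1 :=
    closure_minimal (Set.preimage_mono Set.Ioo_subset_Icc_self)
      (isClosed_Icc.preimage Complex.continuous_re)
  have hdiff : DiffContOnCl ℂ g (Complex.HadamardThreeLines.verticalStrip 0 1) :=
    DifferentiableOn.diffContOnCl fun w hw => by
      have := hd w (hsub hw)
      exact DifferentiableAt.differentiableWithinAt (by fun_prop)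
  have hbdd : BddAbove ((norm ∘ g) '' Complex.HadamardThreeLines.verticalClosedStrip 0 1) :=
    ⟨_, Set.forall_mem_image.2 fun w hw => hg_le w C c hC hw (hgrowth w hw)⟩
  set K := Real.exp ((4 * k)⁻¹ * θ ^ 2) with hK
  have hK₀ : 0 < K := Real.exp_pos _
  have hg := Complex.HadamardThreeLines.norm_le_interp_of_mem_verticalClosedStrip₀₁' g (z := z)
    (a := K * a) (b := K * b) hz hdiff hbdd
    (fun w hw => hg_le w a θ ha₀ (by simp_all) (ha w hw))
    (fun w hw => hg_le w b θ hb₀ (by simp_all) (hb w hw))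
  rw [Real.mul_rpow hK₀.le ha₀, Real.mul_rpow hK₀.le hb₀, mul_mul_mul_comm, ← Real.rpow_add hK₀,
    sub_add_cancel, Real.rpow_one, norm_smul, norm_exp_mul_sq_sub, Real.exp_neg,
    inv_mul_le_iff₀ (Real.exp_pos _), ← mul_assoc, hK, ← Real.exp_add] at hg
  exact hg

theorem sum_norm_rpow_le_of_three_lines {ι : Type*} [Fintype ι] {p : ℝ} (hp : 1 ≤ p)
    {f : ι → ℂ → ℂ} {C : ι → ℝ}
    (hd : ∀ i z, z.re ∈ Set.Icc 0 1 → DifferentiableAt ℂ (f i) z)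
    (hgrowth : ∀ i z, z.re ∈ Set.Icc 0 1 → ‖f i z‖ ≤ C i * Real.exp (c * |z.im|))
    (ha₀ : 0 ≤ a) (hb₀ : 0 ≤ b)
    (ha : ∀ z, z.re = 0 → ∑ i, ‖f i z‖ ^ p ≤ (a * Real.exp (θ * |z.im|)) ^ p)
    (hb : ∀ z, z.re = 1 → ∑ i, ‖f i z‖ ^ p ≤ (b * Real.exp (θ * |z.im|)) ^ p) (hk : 0 < k)
    {z : ℂ} (hz : z.re ∈ Set.Icc 0 1) :
    ∑ i, ‖f i z‖ ^ p ≤ (Real.exp (k * z.im ^ 2 + k * z.re * (1 - z.re) + (4 * k)⁻¹ * θ ^ 2)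
      * (a ^ (1 - z.re) * b ^ z.re)) ^ p := by
  have hp₀ : 0 < p := by linarith
  have : Fact (1 ≤ ENNReal.ofReal p) := ⟨by simpa using hp⟩
  have hpt : (ENNReal.ofReal p).toReal = p := ENNReal.toReal_ofReal hp₀.le
  set F : ℂ → PiLp (ENNReal.ofReal p) (fun _ : ι => ℂ) := fun w =>
    WithLp.toLp _ fun i => f i w
  have hnorm : ∀ w, ‖F w‖ = (∑ i, ‖f i w‖ ^ p) ^ (1 / p) := fun w => by
    rw [PiLp.norm_eq_sum (by rw [hpt]; exact hp₀), hpt]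
  have hnorm_le : ∀ w {t : ℝ}, 0 ≤ t → (‖F w‖ ≤ t ↔ ∑ i, ‖f i w‖ ^ p ≤ t ^ p) :=
    fun w t ht => by
      rw [hnorm, one_div]
      exact Real.rpow_inv_le_iff_of_pos (Finset.sum_nonneg fun i _ => by positivity) ht hp₀
  rw [← hnorm_le z (by positivity)]
  have hC : ∀ i, 0 ≤ C i := fun i => nonneg_of_mul_nonneg_left
    ((norm_nonneg _).trans (hgrowth i z hz)) (Real.exp_pos _)
  have hF_growth : ∀ w, w.re ∈ Set.Icc 0 1 →
      ‖F w‖ ≤ (∑ i, C i ^ p) ^ (1 / p) * Real.exp (c * |w.im|) := fun w hw => by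
    have hsum : 0 ≤ ∑ i, C i ^ p := Finset.sum_nonneg fun i _ => Real.rpow_nonneg (hC i) p
    rw [hnorm_le w (by positivity), Real.mul_rpow (by positivity) (by positivity),
      ← Real.rpow_mul hsum, one_div, inv_mul_cancel₀ hp₀.ne', Real.rpow_one, Finset.sum_mul]
    refine Finset.sum_le_sum fun i _ => ?_
    rw [← Real.mul_rpow (hC i) (by positivity)]
    exact Real.rpow_le_rpow (norm_nonneg _) (hgrowth i w hw) hp₀.le
  exact norm_le_of_three_lines (fun w hw => (differentiableAt_piLp _).2 fun i => hd i w hw)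
    hF_growth ha₀ hb₀ (fun w hw => (hnorm_le w (by positivity)).2 (ha w hw))
    (fun w hw => (hnorm_le w (by positivity)).2 (hb w hw)) hk hz

end ThreeLines

/-! ### Interpolation of Schatten bounds -/

section SumEstimates

variable {ι H₁ H₂ : Type*} [Fintype ι]
  [NormedAddCommGroup H₁] [InnerProductSpace ℂ H₁]
  [NormedAddCommGroup H₂] [InnerProductSpace ℂ H₂] [CompleteSpace H₂]

theorem MemSchatten.sum_norm_inner_adjoint_rpow_le [CompleteSpace H₁] {p : ℝ} (hp : 1 ≤ p)
    {A : H₂ →L[ℂ] H₁} (hA : MemSchatten p A) (x : ι → H₁) (y : ι → H₂) :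
    ∑ i, ‖inner ℂ (y i) (A.adjoint (x i))‖ ^ p
      ≤ (‖synthesis x‖ * ‖synthesis y‖ * schattenNorm p A) ^ p := by
  simp_rw [ContinuousLinearMap.adjoint_inner_right, norm_inner_symm (A _)]
  rw [mul_comm ‖synthesis x‖]
  exact hA.sum_norm_inner_rpow_le hp y x

theorem sum_norm_inner_conjugate_le {p a b₁ b₂ : ℝ} (hp : 0 ≤ p) (ha : 0 ≤ a)
    {A : H₁ →L[ℂ] H₂}
    (hA : ∀ (x : ι → H₁) (y : ι → H₂), ∑ i, ‖inner ℂ (y i) (A (x i))‖ ^ p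
      ≤ (‖synthesis x‖ * ‖synthesis y‖ * a) ^ p)
    {W₁ : H₁ →L[ℂ] H₁} {W₂ : H₂ →L[ℂ] H₂} (hW₁ : ‖W₁‖ ≤ b₁) (hW₂ : ‖W₂‖ ≤ b₂)
    (x : ι → H₁) (y : ι → H₂) :
    ∑ i, ‖inner ℂ (y i) (W₂ (A (W₁ (x i))))‖ ^ p
      ≤ (b₁ * ‖synthesis x‖ * (b₂ * ‖synthesis y‖) * a) ^ p := by
  have hx : ‖synthesis fun i => W₁ (x i)‖ ≤ b₁ * ‖synthesis x‖ :=
    (norm_synthesis_comp_le W₁ x).trans (by gcongr)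
  have hy : ‖synthesis fun i => W₂.adjoint (y i)‖ ≤ b₂ * ‖synthesis y‖ := by
    refine (norm_synthesis_comp_le W₂.adjoint y).trans ?_
    rw [LinearIsometryEquiv.norm_map]
    gcongr
  have h := hA (fun i => W₁ (x i)) (fun i => W₂.adjoint (y i))
  simp_rw [ContinuousLinearMap.adjoint_inner_left] at h
  refine h.trans (Real.rpow_le_rpow (by positivity) ?_ hp)
  have hb : 0 ≤ b₁ * ‖synthesis x‖ := (norm_nonneg _).trans hx
  gcongr

theorem mul_rpow_mul_mul_rpow {a b c : ℝ} (ha : 0 ≤ a) (hb : 0 ≤ b) (hc : 0 ≤ c) (t : ℝ) :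
    (c * a) ^ (1 - t) * (c * b) ^ t = c * (a ^ (1 - t) * b ^ t) := by
  have hc' : c ^ (1 - t) * c ^ t = c := by
    rw [← Real.rpow_add' hc (by simp), sub_add_cancel, Real.rpow_one]
  rw [Real.mul_rpow hc ha, Real.mul_rpow hc hb]
  linear_combination a ^ (1 - t) * b ^ t * hc'

end SumEstimates

namespace IsNegPowFamily

variable {H : Type*} [NormedAddCommGroup H] [InnerProductSpace ℂ H]
  {Q : H →L[ℂ] H} {V : ℂ → H →L[ℂ] H} {N θ : ℝ} {z : ℂ}

theorem nonneg (hV : IsNegPowFamily Q V N θ) : 0 ≤ N := by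
  simpa using (norm_nonneg _).trans (hV.norm_le 0 rfl)

theorem inverse_apply (hV : IsNegPowFamily Q V N θ) (hz : 0 ≤ z.re) (v : H) :
    Q (V z v) = V (z + 1) v :=
  DFunLike.congr_fun (hV.inverse_mul z hz) v

theorem apply_inverse (hV : IsNegPowFamily Q V N θ) (hz : 0 ≤ z.re) (v : H) :
    V z (Q v) = V (z + 1) v :=
  DFunLike.congr_fun (hV.mul_inverse z hz) v

theorem inverse_comm (hV : IsNegPowFamily Q V N θ) (hz : 0 ≤ z.re) (v : H) :
    Q (V z v) = V z (Q v) := by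
  rw [hV.inverse_apply hz, hV.apply_inverse hz]

end IsNegPowFamily

section Density

variable {ι E F G X Y : Type*}
  [NormedAddCommGroup E] [InnerProductSpace ℂ E]
  [NormedAddCommGroup F] [InnerProductSpace ℂ F]
  [NormedAddCommGroup G] [InnerProductSpace ℂ G]

theorem sum_norm_inner_rpow_le_of_denseRange [Fintype ι] {p M : ℝ} (hp : 0 ≤ p) {B : E →L[ℂ] F}
    {R₁ : X → E} {R₂ : Y → F} (hR₁ : DenseRange R₁) (hR₂ : DenseRange R₂)
    (hB : ∀ (h : ι → X) (g : ι → Y), ∑ i, ‖inner ℂ (R₂ (g i)) (B (R₁ (h i)))‖ ^ p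
      ≤ (M * (‖synthesis fun i => R₁ (h i)‖ * ‖synthesis fun i => R₂ (g i)‖)) ^ p)
    (x : ι → E) (y : ι → F) :
    ∑ i, ‖inner ℂ (y i) (B (x i))‖ ^ p ≤ (M * (‖synthesis x‖ * ‖synthesis y‖)) ^ p := by
  have hsynth₁ := continuous_synthesis (ι := ι) (E := E)
  have hsynth₂ := continuous_synthesis (ι := ι) (E := F)
  have hrange : DenseRange (Prod.map (fun (h : ι → X) i => R₁ (h i))
      (fun (g : ι → Y) i => R₂ (g i))) :=
    (DenseRange.piMap fun _ => hR₁).prodMap (DenseRange.piMap fun _ => hR₂)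
  refine hrange.induction_on (p := fun q : (ι → E) × (ι → F) =>
    ∑ i, ‖inner ℂ (q.2 i) (B (q.1 i))‖ ^ p ≤ (M * (‖synthesis q.1‖ * ‖synthesis q.2‖)) ^ p)
    (x, y) ?_ fun q => hB q.1 q.2
  refine isClosed_le (continuous_finsetSum _ fun i _ => ?_) ?_ <;>
    exact Continuous.rpow_const (by fun_prop) fun _ => Or.inr hp

theorem norm_le_of_forall_denseRange_norm_inner_le {R : Y → F} (hR : DenseRange R) {v : F} {M : ℝ}
    (h : ∀ y, ‖inner ℂ (R y) v‖ ≤ M * ‖R y‖) (hM : 0 ≤ M) : ‖v‖ ≤ M := by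
  have hdual : ∀ u, ‖inner ℂ v u‖ ≤ M * ‖u‖ := fun u =>
    hR.induction_on (p := fun u => ‖inner ℂ v u‖ ≤ M * ‖u‖) u
      (isClosed_le (by fun_prop) (by fun_prop)) fun y => by rw [norm_inner_symm]; exact h y
  rw [← innerSL_apply_norm ℂ v]
  exact ContinuousLinearMap.opNorm_le_bound _ hM hdual

theorem exists_clm_apply_eq_of_norm_inner_le [CompleteSpace F] {C : E →L[ℂ] F} {Q : E →L[ℂ] G}
    {P : X → E} {R : Y → F} {M : ℝ} (hQ : DenseRange Q) (hP : DenseRange P) (hR : DenseRange R)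
    (hM : 0 ≤ M) (h : ∀ x y, ‖inner ℂ (R y) (C (P x))‖ ≤ M * (‖Q (P x)‖ * ‖R y‖)) :
    ∃ B : G →L[ℂ] F, ∀ u, B (Q u) = C u := by
  have hC : ∀ u, ‖C u‖ ≤ M * ‖Q u‖ := fun u =>
    hP.induction_on (p := fun u => ‖C u‖ ≤ M * ‖Q u‖) u
      (isClosed_le (by fun_prop) (by fun_prop)) fun x =>
        norm_le_of_forall_denseRange_norm_inner_le hR
          (fun y => (h x y).trans_eq (mul_assoc _ _ _).symm) (by positivity)
  exact ⟨(C : E →ₗ[ℂ] F).extendOfNorm (Q : E →ₗ[ℂ] G), fun u =>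
    LinearMap.extendOfNorm_eq (f := (C : E →ₗ[ℂ] F)) (e := (Q : E →ₗ[ℂ] G)) hQ ⟨M, hC⟩ u⟩

end Density

section Interpolation

variable {H₁ H₂ : Type*}
  [NormedAddCommGroup H₁] [InnerProductSpace ℂ H₁]
  [NormedAddCommGroup H₂] [InnerProductSpace ℂ H₂]
  {Q₁ : H₁ →L[ℂ] H₁} {Q₂ : H₂ →L[ℂ] H₂} {V₁ : ℂ → H₁ →L[ℂ] H₁} {V₂ : ℂ → H₂ →L[ℂ] H₂}
  {N₁ N₂ θ₁ θ₂ : ℝ} {A₁ : H₁ →L[ℂ] H₂} {A₂ : H₂ →L[ℂ] H₁} {p : ℝ} {z : ℂ}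

/-- The family `T₂⁻¹ T₂^{-z} A T₁^{-(1-z)} T₁⁻¹` with `Vⱼ w = Tⱼ^{-w}`; the two additional factors
make it norm-analytic up to the edges of the strip `0 ≤ Re z ≤ 1`. -/
def regularizedSandwich (A : H₁ →L[ℂ] H₂) (V₁ : ℂ → H₁ →L[ℂ] H₁) (V₂ : ℂ → H₂ →L[ℂ] H₂)
    (z : ℂ) : H₁ →L[ℂ] H₂ :=
  V₂ (z + 1) ∘L A ∘L V₁ (2 - z)

theorem differentiableAt_regularizedSandwich (h₁ : IsNegPowFamily Q₁ V₁ N₁ θ₁)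
    (h₂ : IsNegPowFamily Q₂ V₂ N₂ θ₂) (A : H₁ →L[ℂ] H₂) (hz : z.re ∈ Set.Icc 0 1) :
    DifferentiableAt ℂ (regularizedSandwich A V₁ V₂) z := by
  have hV₂ : DifferentiableAt ℂ (fun w => V₂ (w + 1)) z :=
    DifferentiableAt.comp (g := V₂) (f := fun w => w + 1) z
      (h₂.differentiableAt _ (by simp; linarith [hz.1])) (by fun_prop)
  have hV₁ : DifferentiableAt ℂ (fun w => V₁ (2 - w)) z :=
    DifferentiableAt.comp (g := V₁) (f := fun w => 2 - w) z
      (h₁.differentiableAt _ (by simp; linarith [hz.2])) (by fun_prop)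
  exact hV₂.clm_comp ((differentiableAt_const A).clm_comp hV₁)

theorem exists_norm_regularizedSandwich_le (h₁ : IsNegPowFamily Q₁ V₁ N₁ θ₁)
    (h₂ : IsNegPowFamily Q₂ V₂ N₂ θ₂) (A : H₁ →L[ℂ] H₂) :
    ∃ C : ℝ, ∀ z : ℂ, z.re ∈ Set.Icc 0 1 →
      ‖regularizedSandwich A V₁ V₂ z‖ ≤ C * Real.exp (2 * Real.pi * |z.im|) := by
  obtain ⟨C₁, hC₁⟩ := h₁.growth
  obtain ⟨C₂, hC₂⟩ := h₂.growth
  refine ⟨C₂ * (‖A‖ * C₁), fun z hz => ?_⟩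
  have hV₁ : ‖V₁ (2 - z)‖ ≤ C₁ * Real.exp (Real.pi * |z.im|) := by
    simpa using hC₁ (2 - z) ⟨by simp; linarith [hz.2], by simpa using hz.1⟩
  have hV₂ : ‖V₂ (z + 1)‖ ≤ C₂ * Real.exp (Real.pi * |z.im|) := by
    simpa using hC₂ (z + 1) ⟨by simpa using hz.1, by simp; linarith [hz.2]⟩
  calc ‖regularizedSandwich A V₁ V₂ z‖
      ≤ ‖V₂ (z + 1)‖ * (‖A‖ * ‖V₁ (2 - z)‖) :=
        (ContinuousLinearMap.opNorm_comp_le _ _).trans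
          (mul_le_mul_of_nonneg_left (ContinuousLinearMap.opNorm_comp_le _ _) (norm_nonneg _))
    _ ≤ C₂ * Real.exp (Real.pi * |z.im|) * (‖A‖ * (C₁ * Real.exp (Real.pi * |z.im|))) :=
        mul_le_mul hV₂ (by gcongr) (by positivity) ((norm_nonneg _).trans hV₂)
    _ = C₂ * (‖A‖ * C₁) * Real.exp (2 * Real.pi * |z.im|) := by
        rw [two_mul, add_mul, Real.exp_add]
        ring

theorem regularizedSandwich_apply (h₁ : IsNegPowFamily Q₁ V₁ N₁ θ₁)
    (h₂ : IsNegPowFamily Q₂ V₂ N₂ θ₂) (A : H₁ →L[ℂ] H₂) (hz : z.re ∈ Set.Icc 0 1) (v : H₁) :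
    regularizedSandwich A V₁ V₂ z v = Q₂ (V₂ z (A (V₁ (1 - z) (Q₁ v)))) := by
  have hshift : (2 : ℂ) - z = 1 - z + 1 := by ring
  rw [h₂.inverse_apply hz.1, h₁.apply_inverse (by simpa using hz.2), ← hshift]
  rfl

theorem regularizedSandwich_apply_of_re_eq_zero (h₁ : IsNegPowFamily Q₁ V₁ N₁ θ₁)
    (h₂ : IsNegPowFamily Q₂ V₂ N₂ θ₂) (A : H₁ →L[ℂ] H₂) (hz : z.re = 0) (v : H₁) :
    regularizedSandwich A V₁ V₂ z v = Q₂ (V₂ z (A (V₁ (-z) (Q₁ (Q₁ v))))) := by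
  rw [regularizedSandwich_apply h₁ h₂ A (by simp [hz]), h₁.apply_inverse (z := -z) (by simp [hz]),
    neg_add_eq_sub]

theorem regularizedSandwich_apply_of_re_eq_one (h₁ : IsNegPowFamily Q₁ V₁ N₁ θ₁)
    (h₂ : IsNegPowFamily Q₂ V₂ N₂ θ₂) {A A' : H₁ →L[ℂ] H₂} (hA : Q₂ ∘L A = A' ∘L Q₁)
    (hz : z.re = 1) (v : H₁) :
    regularizedSandwich A V₁ V₂ z v = Q₂ (V₂ (z - 1) (A' (V₁ (1 - z) (Q₁ (Q₁ v))))) := by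
  have hA' : ∀ u, A' (Q₁ u) = Q₂ (A u) := fun u => (DFunLike.congr_fun hA u).symm
  rw [regularizedSandwich_apply h₁ h₂ A (by simp [hz]), ← h₁.inverse_comm (by simp [hz]) (Q₁ v),
    hA', h₂.apply_inverse (by simp [hz]), sub_add_cancel]

/-- The bound for the `p`-Schatten norm at the point `z` of the strip, with the free parameter `k`
and the norms `a₁`, `a₂` of the two endpoint operators. -/
def interpBound (N₁ N₂ θ₁ θ₂ a₁ a₂ k : ℝ) (z : ℂ) : ℝ :=
  N₁ * N₂ * Real.exp (k * z.im ^ 2 + k * z.re * (1 - z.re) + (4 * k)⁻¹ * (θ₁ + θ₂) ^ 2)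
    * a₁ ^ (1 - z.re) * a₂ ^ z.re

theorem interpBound_nonneg (hN₁ : 0 ≤ N₁) (hN₂ : 0 ≤ N₂) {a₁ a₂ : ℝ} (ha₁ : 0 ≤ a₁) (ha₂ : 0 ≤ a₂)
    (k : ℝ) (z : ℂ) : 0 ≤ interpBound N₁ N₂ θ₁ θ₂ a₁ a₂ k z := by
  unfold interpBound
  positivity

variable [CompleteSpace H₂] {ι : Type*} [Fintype ι]

theorem sum_norm_inner_conjugate_negPow_le (h₁ : IsNegPowFamily Q₁ V₁ N₁ θ₁)
    (h₂ : IsNegPowFamily Q₂ V₂ N₂ θ₂) (hp : 0 ≤ p) {a : ℝ} (ha : 0 ≤ a) {A : H₁ →L[ℂ] H₂}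
    (hA : ∀ (x : ι → H₁) (y : ι → H₂), ∑ i, ‖inner ℂ (y i) (A (x i))‖ ^ p
      ≤ (‖synthesis x‖ * ‖synthesis y‖ * a) ^ p)
    {w₁ w₂ : ℂ} {t : ℝ} (hw₁ : w₁.re = 0) (hw₂ : w₂.re = 0) (ht₁ : |w₁.im| = |t|)
    (ht₂ : |w₂.im| = |t|) (x : ι → H₁) (y : ι → H₂) :
    ∑ i, ‖inner ℂ (y i) (V₂ w₂ (A (V₁ w₁ (x i))))‖ ^ p
      ≤ (N₁ * N₂ * (‖synthesis x‖ * ‖synthesis y‖) * a * Real.exp ((θ₁ + θ₂) * |t|)) ^ p := by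
  refine (sum_norm_inner_conjugate_le hp ha hA (h₁.norm_le w₁ hw₁) (h₂.norm_le w₂ hw₂)
    x y).trans_eq ?_
  rw [ht₁, ht₂, add_mul, Real.exp_add]
  ring_nf

theorem sum_norm_inner_regularizedSandwich_le [CompleteSpace H₁] (h₁ : IsNegPowFamily Q₁ V₁ N₁ θ₁)
    (h₂ : IsNegPowFamily Q₂ V₂ N₂ θ₂) (hA : Q₂ ∘L A₁ = A₂.adjoint ∘L Q₁)
    (hp : 1 ≤ p) (hA₁ : MemSchatten p A₁) (hA₂ : MemSchatten p A₂)
    {k : ℝ} (hk : 0 < k) (hz : z.re ∈ Set.Icc 0 1) (h : ι → H₁) (g : ι → H₂) :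
    ∑ i, ‖inner ℂ (g i) (regularizedSandwich A₁ V₁ V₂ z (h i))‖ ^ p
      ≤ (interpBound N₁ N₂ θ₁ θ₂ (schattenNorm p A₁) (schattenNorm p A₂) k z
        * (‖synthesis fun i => Q₁ (Q₁ (h i))‖ * ‖synthesis fun i => Q₂.adjoint (g i)‖)) ^ p := by
  have hN₁ := h₁.nonneg
  have hN₂ := h₂.nonneg
  have ha₁ := schattenNorm_nonneg p A₁
  have ha₂ := schattenNorm_nonneg p A₂
  have hp₀ : 0 ≤ p := zero_le_one.trans hp
  set c := N₁ * N₂ * (‖synthesis fun i => Q₁ (Q₁ (h i))‖ * ‖synthesis fun i => Q₂.adjoint (g i)‖)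
  have hc : 0 ≤ c := by positivity
  obtain ⟨C, hC⟩ := exists_norm_regularizedSandwich_le h₁ h₂ A₁
  refine (sum_norm_rpow_le_of_three_lines hp (a := c * schattenNorm p A₁)
    (b := c * schattenNorm p A₂) (θ := θ₁ + θ₂) (c := 2 * Real.pi)
    (f := fun i w => inner ℂ (g i) (regularizedSandwich A₁ V₁ V₂ w (h i)))
    (C := fun i => ‖g i‖ * (C * ‖h i‖)) ?_ ?_ (by positivity) (by positivity) ?_ ?_ hk
    hz).trans_eq ?_
  · intro i w hw
    exact (innerSL ℂ (g i)).differentiableAt.comp w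
      ((differentiableAt_regularizedSandwich h₁ h₂ A₁ hw).clm_apply (differentiableAt_const _))
  · intro i w hw
    calc ‖inner ℂ (g i) (regularizedSandwich A₁ V₁ V₂ w (h i))‖
        ≤ ‖g i‖ * ‖regularizedSandwich A₁ V₁ V₂ w (h i)‖ := norm_inner_le_norm _ _
      _ ≤ ‖g i‖ * (C * Real.exp (2 * Real.pi * |w.im|) * ‖h i‖) := by
          gcongr
          exact ContinuousLinearMap.le_of_opNorm_le _ (hC w hw) _
      _ = ‖g i‖ * (C * ‖h i‖) * Real.exp (2 * Real.pi * |w.im|) := by ring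
  · intro w hw
    simp_rw [regularizedSandwich_apply_of_re_eq_zero h₁ h₂ A₁ hw,
      ← ContinuousLinearMap.adjoint_inner_left Q₂]
    exact sum_norm_inner_conjugate_negPow_le h₁ h₂ hp₀ ha₁ (hA₁.sum_norm_inner_rpow_le hp)
      (by simp [hw]) hw (by simp) rfl _ _
  · intro w hw
    simp_rw [regularizedSandwich_apply_of_re_eq_one h₁ h₂ hA hw,
      ← ContinuousLinearMap.adjoint_inner_left Q₂]
    exact sum_norm_inner_conjugate_negPow_le h₁ h₂ hp₀ ha₂
      (hA₂.sum_norm_inner_adjoint_rpow_le hp) (by simp [hw]) (by simp [hw]) (by simp) (by simp) _ _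
  · rw [mul_rpow_mul_mul_rpow ha₁ ha₂ hc, interpBound]
    simp only [c]
    ring_nf

theorem exists_bounded_interpolant [CompleteSpace H₁]
    (h₁ : IsNegPowFamily Q₁ V₁ N₁ θ₁) (h₂ : IsNegPowFamily Q₂ V₂ N₂ θ₂)
    (hQ₁ : DenseRange Q₁) (hQ₂ : DenseRange Q₂.adjoint)
    (hA : Q₂ ∘L A₁ = A₂.adjoint ∘L Q₁) (hp : 1 ≤ p) (hA₁ : MemSchatten p A₁)
    (hA₂ : MemSchatten p A₂) (hz : z.re ∈ Set.Icc 0 1) :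
    ∃ B : H₁ →L[ℂ] H₂, (∀ u, B (Q₁ u) = V₂ z (A₁ (V₁ (1 - z) u))) ∧ MemSchatten p B ∧
      ∀ k : ℝ, 0 < k → schattenNorm p B ≤
        interpBound N₁ N₂ θ₁ θ₂ (schattenNorm p A₁) (schattenNorm p A₂) k z := by
  have hp₀ : 0 < p := one_pos.trans_le hp
  set M : ℝ → ℝ := fun k =>
    interpBound N₁ N₂ θ₁ θ₂ (schattenNorm p A₁) (schattenNorm p A₂) k z
  have hM : ∀ k, 0 ≤ M k := fun k => interpBound_nonneg h₁.nonneg h₂.nonneg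
    (schattenNorm_nonneg p A₁) (schattenNorm_nonneg p A₂) k z
  have hstrip {k : ℝ} (hk : 0 < k) {n : ℕ} (h : Fin n → H₁) (g : Fin n → H₂) :
      ∑ i, ‖inner ℂ (Q₂.adjoint (g i)) (V₂ z (A₁ (V₁ (1 - z) (Q₁ (h i)))))‖ ^ p ≤ (M k *
        (‖synthesis fun i => Q₁ (Q₁ (h i))‖ * ‖synthesis fun i => Q₂.adjoint (g i)‖)) ^ p := by
    simp_rw [ContinuousLinearMap.adjoint_inner_left,
      ← regularizedSandwich_apply h₁ h₂ A₁ hz]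
    exact sum_norm_inner_regularizedSandwich_le h₁ h₂ hA hp hA₁ hA₂ hk hz h g
  obtain ⟨B, hB⟩ : ∃ B : H₁ →L[ℂ] H₂, ∀ u, B (Q₁ u) = (V₂ z ∘L A₁ ∘L V₁ (1 - z)) u := by
    refine exists_clm_apply_eq_of_norm_inner_le hQ₁ hQ₁ hQ₂ (hM 1) fun h g => ?_
    have hle := hstrip one_pos (fun _ : Fin 1 => h) fun _ => g
    rw [Finset.univ_unique, Finset.sum_singleton,
      Real.rpow_le_rpow_iff (norm_nonneg _) (mul_nonneg (hM 1) (by positivity)) hp₀] at hle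
    refine hle.trans (mul_le_mul_of_nonneg_left ?_ (hM 1))
    gcongr <;> exact norm_synthesis_const_le _
  have hpair {k : ℝ} (hk : 0 < k) {n : ℕ} (x : Fin n → H₁) (y : Fin n → H₂) :
      ∑ i, ‖inner ℂ (y i) (B (x i))‖ ^ p ≤ (M k * (‖synthesis x‖ * ‖synthesis y‖)) ^ p :=
    sum_norm_inner_rpow_le_of_denseRange hp₀.le (hQ₁.comp hQ₁ Q₁.continuous) hQ₂
      (fun h g => by
        simpa only [Function.comp_apply, hB, ContinuousLinearMap.comp_apply] using hstrip hk h g)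
      x y
  have hmem {k : ℝ} (hk : 0 < k) : MemSchatten p B ∧ schattenNorm p B ≤ M k :=
    memSchatten_of_sum_norm_inner_rpow_le hp₀ (hM k) fun n x y hx hy =>
      (hpair hk x y).trans <| Real.rpow_le_rpow (mul_nonneg (hM k) (by positivity))
        (mul_le_of_le_one_right (hM k) (mul_le_one₀ (norm_synthesis_le_one hx) (norm_nonneg _)
          (norm_synthesis_le_one hy))) hp₀.le
  exact ⟨B, hB, (hmem one_pos).1, fun k hk => (hmem hk).2⟩

end Interpolation

/-! ### Products, inverses and closures of unbounded operators -/

section Unbounded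

variable {E F G : Type*}
  [NormedAddCommGroup E] [InnerProductSpace ℂ E]
  [NormedAddCommGroup F] [InnerProductSpace ℂ F]
  [NormedAddCommGroup G] [InnerProductSpace ℂ G]

theorem mem_opProd_domain_iff {A : F →ₗ.[ℂ] G} {B : E →ₗ.[ℂ] F} {x : E} :
    x ∈ (opProd A B).domain ↔ ∃ h : x ∈ B.domain, B ⟨x, h⟩ ∈ A.domain := by
  constructor
  · rintro ⟨y, hy, rfl⟩
    exact ⟨y.2, hy⟩
  · rintro ⟨h, h'⟩
    exact ⟨⟨x, h⟩, h', rfl⟩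

theorem mem_graph_ofBounded_iff {B : E →L[ℂ] F} {q : E × F} :
    q ∈ (ofBounded B).graph ↔ q.2 = B q.1 := by
  rw [LinearPMap.mem_graph_iff]
  constructor
  · rintro ⟨y, hy₁, hy₂⟩
    rw [← hy₂, ← hy₁]
    rfl
  · exact fun hq => ⟨⟨q.1, trivial⟩, rfl, hq.symm⟩

theorem isClosed_graph_ofBounded (B : E →L[ℂ] F) :
    IsClosed ((ofBounded B).graph : Set (E × F)) := by
  have hgraph : ((ofBounded B).graph : Set (E × F)) = {q | q.2 = B q.1} :=
    Set.ext fun q => mem_graph_ofBounded_iff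
  rw [hgraph]
  exact isClosed_eq (by fun_prop) (by fun_prop)

theorem topologicalClosure_graph_eq_graph_ofBounded {A : E →ₗ.[ℂ] F} {B : E →L[ℂ] F}
    (hA : Dense (A.domain : Set E)) (h : ∀ x (hx : x ∈ A.domain), A ⟨x, hx⟩ = B x) :
    A.graph.topologicalClosure = (ofBounded B).graph := by
  apply le_antisymm
  · refine Submodule.topologicalClosure_minimal _ (fun q hq => ?_) (isClosed_graph_ofBounded B)
    obtain ⟨x, hx, hAx⟩ := (LinearPMap.mem_graph_iff A).1 hq
    rw [mem_graph_ofBounded_iff, ← hAx, ← hx]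
    exact h x x.2
  · rintro ⟨x, y⟩ hxy
    obtain rfl : y = B x := mem_graph_ofBounded_iff.1 hxy
    refine map_mem_closure (f := fun x : E => (x, B x)) (by fun_prop) (hA x) fun w hw => ?_
    exact (LinearPMap.mem_graph_iff A).2 ⟨⟨w, hw⟩, rfl, h w hw⟩

theorem isClosable_and_closure_eq_ofBounded {A : E →ₗ.[ℂ] F} {B : E →L[ℂ] F}
    (hA : Dense (A.domain : Set E)) (h : ∀ x (hx : x ∈ A.domain), A ⟨x, hx⟩ = B x) :
    A.IsClosable ∧ A.closure = ofBounded B := by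
  have hgraph := topologicalClosure_graph_eq_graph_ofBounded hA h
  have hcl : A.IsClosable := ⟨_, hgraph⟩
  exact ⟨hcl, LinearPMap.eq_of_eq_graph (hcl.graph_closure_eq_closure_graph.symm.trans hgraph)⟩

theorem isClosable_domRestrict_and_closure_eq_ofBounded {A : E →ₗ.[ℂ] F} {D : Submodule ℂ E}
    {B : E →L[ℂ] F} (hD : Dense (D : Set E))
    (h : ∀ x ∈ D, ∃ hx : x ∈ A.domain, A ⟨x, hx⟩ = B x) :
    D ≤ A.domain ∧ (A.domRestrict D).IsClosable ∧ (A.domRestrict D).closure = ofBounded B := by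
  have hle : D ≤ A.domain := fun x hx => (h x hx).choose
  refine ⟨hle, isClosable_and_closure_eq_ofBounded ?_ fun x hx => ?_⟩
  · rwa [LinearPMap.domRestrict_domain, inf_eq_left.2 hle]
  · obtain ⟨hxA, hAx⟩ := h x hx.1
    rw [← hAx]
    exact LinearPMap.domRestrict_apply rfl

theorem exists_of_opProd_inverse_eq {T : E →ₗ.[ℂ] F} (hker : LinearMap.ker T.toFun = ⊥)
    {S : E →ₗ.[ℂ] G} {A : F →L[ℂ] G} (hA : opProd S T.inverse = ofBounded A) (y : F) :
    ∃ (x : E) (hx : x ∈ T.domain) (hx' : x ∈ S.domain), T ⟨x, hx⟩ = y ∧ S ⟨x, hx'⟩ = A y := by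
  have hy : y ∈ (opProd S T.inverse).domain := by rw [hA]; trivial
  obtain ⟨hyT, hyS⟩ := mem_opProd_domain_iff.1 hy
  obtain ⟨x, hx⟩ : y ∈ LinearMap.range T.toFun := by rwa [← LinearPMap.inverse_domain]
  have hinv : T.inverse ⟨y, hyT⟩ = x := LinearPMap.inverse_apply_eq hker hx
  have hSA : S ⟨T.inverse ⟨y, hyT⟩, hyS⟩ = A y := apply_of_eq_ofBounded hA y hy
  simp only [hinv] at hSA hyS
  exact ⟨x, x.2, hyS, hx, hSA⟩

theorem adjoint_ker_eq_bot [CompleteSpace E] {T : E →ₗ.[ℂ] E} (hd : Dense (T.domain : Set E))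
    (hT : Function.Surjective T) : LinearMap.ker T†.toFun = ⊥ := by
  rw [LinearMap.ker_eq_bot']
  intro k (hk : T† k = 0)
  obtain ⟨x, hx⟩ := hT k
  have h := LinearPMap.adjoint_isFormalAdjoint hd k x
  rw [hk, hx, inner_zero_left] at h
  exact Subtype.ext (inner_self_eq_zero.1 h.symm)

end Unbounded

namespace IsResolventAt

variable {H : Type*} [NormedAddCommGroup H] [InnerProductSpace ℂ H]
  {T : H →ₗ.[ℂ] H} {Q : H →L[ℂ] H}

theorem inverse_mem (hQ : IsResolventAt T 0 Q) (y : H) : Q y ∈ T.domain :=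
  (hQ.2 y).1

theorem apply_inverse (hQ : IsResolventAt T 0 Q) (y : H) : T ⟨Q y, hQ.inverse_mem y⟩ = y := by
  simpa only [zero_smul, sub_zero] using (hQ.2 y).2

theorem inverse_apply (hQ : IsResolventAt T 0 Q) {x : H} (hx : x ∈ T.domain) :
    Q (T ⟨x, hx⟩) = x := by
  simpa only [zero_smul, sub_zero] using hQ.1 ⟨x, hx⟩

theorem surjective (hQ : IsResolventAt T 0 Q) : Function.Surjective T :=
  fun y => ⟨_, hQ.apply_inverse y⟩

theorem denseRange (hQ : IsResolventAt T 0 Q) (hd : Dense (T.domain : Set H)) : DenseRange Q :=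
  hd.mono fun x hx => ⟨T ⟨x, hx⟩, hQ.inverse_apply hx⟩

theorem ker_eq_bot (hQ : IsResolventAt T 0 Q) : LinearMap.ker T.toFun = ⊥ := by
  rw [LinearMap.ker_eq_bot']
  intro x (hx : T x = 0)
  have h := hQ.inverse_apply x.2
  rw [hx, map_zero] at h
  exact Subtype.ext h.symm

theorem injective (hQ : IsResolventAt T 0 Q) : Function.Injective Q := fun y y' h => by
  rw [← hQ.apply_inverse y, ← hQ.apply_inverse y']
  simp only [h]

theorem denseRange_adjoint [CompleteSpace H] (hQ : IsResolventAt T 0 Q) :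
    DenseRange Q.adjoint := by
  have horth : Q.adjoint.rangeᗮ = ⊥ := by
    rw [ContinuousLinearMap.orthogonal_range, ContinuousLinearMap.adjoint_adjoint]
    exact LinearMap.ker_eq_bot.2 hQ.injective
  rwa [← Submodule.topologicalClosure_eq_top_iff,
    ← Submodule.dense_iff_topologicalClosure_eq_top] at horth

end IsResolventAt

section Sandwich

variable {H₁ H₂ : Type*}
  [NormedAddCommGroup H₁] [InnerProductSpace ℂ H₁]
  [NormedAddCommGroup H₂] [InnerProductSpace ℂ H₂]
  {T₁ : H₁ →ₗ.[ℂ] H₁} {T₂ : H₂ →ₗ.[ℂ] H₂} {S : H₁ →ₗ.[ℂ] H₂}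
  {Q₁ : H₁ →L[ℂ] H₁} {Q₂ : H₂ →L[ℂ] H₂} {A₁ : H₁ →L[ℂ] H₂} {A₂ : H₂ →L[ℂ] H₁}

theorem domain_le_of_opProd_inverse_eq (hQ₁ : IsResolventAt T₁ 0 Q₁)
    (hA₁ : opProd S T₁.inverse = ofBounded A₁) : T₁.domain ≤ S.domain := fun x hx => by
  obtain ⟨w, hw, hwS, hwT, -⟩ := exists_of_opProd_inverse_eq hQ₁.ker_eq_bot hA₁ (T₁ ⟨x, hx⟩)
  rwa [← hQ₁.inverse_apply hx, ← hwT, hQ₁.inverse_apply]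

theorem inverse_comp_eq_adjoint_comp_inverse [CompleteSpace H₁] [CompleteSpace H₂]
    (hQ₁ : IsResolventAt T₁ 0 Q₁) (hQ₂ : IsResolventAt T₂ 0 Q₂)
    (hd₂ : Dense (T₂.domain : Set H₂)) (hdS : Dense (S.domain : Set H₁))
    (hA₁ : opProd S T₁.inverse = ofBounded A₁) (hA₂ : opProd S† T₂†.inverse = ofBounded A₂) :
    Q₂ ∘L A₁ = A₂.adjoint ∘L Q₁ := by
  ext v
  refine ext_inner_left ℂ fun g => ?_
  obtain ⟨k, hkT, hkS, rfl, hkA⟩ :=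
    exists_of_opProd_inverse_eq (adjoint_ker_eq_bot hd₂ hQ₂.surjective) hA₂ g
  obtain ⟨x, hxT, hxS, rfl, hxA⟩ := exists_of_opProd_inverse_eq hQ₁.ker_eq_bot hA₁ v
  calc inner ℂ (T₂† ⟨k, hkT⟩) (Q₂ (A₁ (T₁ ⟨x, hxT⟩)))
      = inner ℂ k (T₂ ⟨Q₂ (A₁ (T₁ ⟨x, hxT⟩)), hQ₂.inverse_mem _⟩) :=
        LinearPMap.adjoint_isFormalAdjoint hd₂ ⟨k, hkT⟩ ⟨_, hQ₂.inverse_mem _⟩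
    _ = inner ℂ k (S ⟨x, hxS⟩) := by rw [hQ₂.apply_inverse, hxA]
    _ = inner ℂ (S† ⟨k, hkS⟩) x :=
        (LinearPMap.adjoint_isFormalAdjoint hdS ⟨k, hkS⟩ ⟨x, hxS⟩).symm
    _ = inner ℂ (T₂† ⟨k, hkT⟩) (A₂.adjoint (Q₁ (T₁ ⟨x, hxT⟩))) := by
        rw [ContinuousLinearMap.adjoint_inner_right, hQ₁.inverse_apply, hkA]

theorem sandwich_apply_of_mem {z : ℂ} {V₁ : H₁ →L[ℂ] H₁} {V₂ : H₂ →L[ℂ] H₂} {B : H₁ →L[ℂ] H₂}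
    (hQ₁ : IsResolventAt T₁ 0 Q₁) (hA₁ : opProd S T₁.inverse = ofBounded A₁)
    (hV₁ : negPow T₁ (1 - z) = ofBounded V₁) (hV₂ : negPow T₂ z = ofBounded V₂)
    (hcomm : ∀ u, Q₁ (V₁ u) = V₁ (Q₁ u)) (hB : ∀ u, B (Q₁ u) = V₂ (A₁ (V₁ u))) {x : H₁}
    (hx : x ∈ T₁.domain) :
    ∃ h : x ∈ (sandwich T₁ T₂ S z).domain, sandwich T₁ T₂ S z ⟨x, h⟩ = B x := by
  obtain ⟨w, hwT, hwS, hwu, hwA⟩ :=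
    exists_of_opProd_inverse_eq hQ₁.ker_eq_bot hA₁ (V₁ (T₁ ⟨x, hx⟩))
  have hVx : V₁ x = w := by
    rw [← hQ₁.inverse_apply hwT, hwu, hcomm, hQ₁.inverse_apply]
  have hBx : B x = V₂ (S ⟨w, hwS⟩) := by
    rw [hwA, ← hB, hQ₁.inverse_apply]
  subst hVx
  rw [sandwich, hV₁, hV₂]
  have hSV : x ∈ (opProd S (ofBounded V₁)).domain := mem_opProd_domain_iff.2 ⟨trivial, hwS⟩
  exact ⟨mem_opProd_domain_iff.2 ⟨hSV, trivial⟩, hBx.symm⟩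

end Sandwich

theorem le_mul_exp_sqrt_of_forall_le {a c d θ q : ℝ} (hc : 0 ≤ c) (hd : 0 ≤ d) (hθ : 0 ≤ θ)
    (hq : 0 ≤ q) (h : ∀ k : ℝ, 0 < k → a ≤ c * Real.exp (k * q + (4 * k)⁻¹ * θ ^ 2) * d) :
    a ≤ c * Real.exp (θ * Real.sqrt q) * d := by
  have hlim : Tendsto (fun η : ℝ => c * Real.exp ((θ + η) * Real.sqrt (q + η)) * d) (𝓝[>] 0)
      (𝓝 (c * Real.exp ((θ + 0) * Real.sqrt (q + 0)) * d)) :=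
    (Continuous.tendsto (by fun_prop) 0).mono_left nhdsWithin_le_nhds
  rw [add_zero, add_zero] at hlim
  refine ge_of_tendsto hlim ?_
  filter_upwards [self_mem_nhdsWithin] with η (hη : 0 < η)
  have hqη : 0 < q + η := by linarith
  -- For `θ, q > 0` the exponent is least at `k = θ / (2 √q)`, where it equals `θ √q`.
  set k := (θ + η) / (2 * Real.sqrt (q + η)) with hk
  have hexp : (θ + η) * Real.sqrt (q + η) = k * (q + η) + (4 * k)⁻¹ * (θ + η) ^ 2 := by
    nth_rewrite 2 [← Real.sq_sqrt hqη.le]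
    rw [hk]
    field_simp
    ring
  refine (h k (by positivity)).trans ?_
  rw [hexp]
  gcongr <;> linarith

section Corollary

variable {H₁ H₂ : Type*}
  [NormedAddCommGroup H₁] [InnerProductSpace ℂ H₁] [CompleteSpace H₁]
  [NormedAddCommGroup H₂] [InnerProductSpace ℂ H₂] [CompleteSpace H₂]
  {T₁ : H₁ →ₗ.[ℂ] H₁} {T₂ : H₂ →ₗ.[ℂ] H₂} {S : H₁ →ₗ.[ℂ] H₂}
  {N₁ N₂ θ₁ θ₂ p : ℝ} {A₁ : H₁ →L[ℂ] H₂} {A₂ : H₂ →L[ℂ] H₁}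

theorem exists_closure_sandwich_eq_ofBounded (hT₁ : IsSectorial T₁) (hT₂ : IsSectorial T₂)
    (h0₁ : (0 : ℂ) ∈ resSet T₁) (h0₂ : (0 : ℂ) ∈ resSet T₂)
    (hBIP₁ : HasBIP T₁ N₁ θ₁) (hBIP₂ : HasBIP T₂ N₂ θ₂) (hp : 1 ≤ p)
    (hA₁ : opProd S T₁.inverse = ofBounded A₁) (hA₁p : MemSchatten p A₁)
    (hA₂ : opProd S† T₂†.inverse = ofBounded A₂) (hA₂p : MemSchatten p A₂)
    {z : ℂ} (hz : z.re ∈ Set.Icc 0 1) :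
    ∃ B : H₁ →L[ℂ] H₂,
      (T₁.domain ≤ (sandwich T₁ T₂ S z).domain ∧
        ((sandwich T₁ T₂ S z).domRestrict T₁.domain).IsClosable ∧
        ((sandwich T₁ T₂ S z).domRestrict T₁.domain).closure = ofBounded B) ∧
      MemSchatten p B ∧
      ∀ k : ℝ, 0 < k → schattenNorm p B ≤
        interpBound N₁ N₂ θ₁ θ₂ (schattenNorm p A₁) (schattenNorm p A₂) k z := by
  obtain ⟨Q₁, hQ₁⟩ := h0₁
  obtain ⟨Q₂, hQ₂⟩ := h0₂
  obtain ⟨ω₁, hω₁⟩ := hT₁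
  obtain ⟨ω₂, hω₂⟩ := hT₂
  have hd₁ := hω₁.dense_domain
  have h₁ := hBIP₁.isNegPowFamily ⟨ω₁, hω₁⟩ hQ₁
  have h₂ := hBIP₂.isNegPowFamily ⟨ω₂, hω₂⟩ hQ₂
  have hz' : 0 ≤ (1 - z).re := by simpa using hz.2
  have hA := inverse_comp_eq_adjoint_comp_inverse hQ₁ hQ₂ hω₂.dense_domain
    (hd₁.mono (domain_le_of_opProd_inverse_eq hQ₁ hA₁)) hA₁ hA₂
  obtain ⟨B, hBQ, hB⟩ := exists_bounded_interpolant h₁ h₂ (hQ₁.denseRange hd₁)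
    hQ₂.denseRange_adjoint hA hp hA₁p hA₂p hz
  exact ⟨B, isClosable_domRestrict_and_closure_eq_ofBounded hd₁ fun x hx =>
    sandwich_apply_of_mem hQ₁ hA₁ (hBIP₁.negPow_eq hz') (hBIP₂.negPow_eq hz.1)
      (h₁.inverse_comm hz') hBQ hx, hB⟩

theorem le_of_forall_le_interpBound {a a₁ a₂ x : ℝ} (hN₁ : 0 ≤ N₁) (hN₂ : 0 ≤ N₂)
    (hθ : 0 ≤ θ₁ + θ₂) (ha₁ : 0 ≤ a₁) (ha₂ : 0 ≤ a₂) (hx : x ∈ Set.Icc 0 1)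
    (h : ∀ k : ℝ, 0 < k → a ≤ interpBound N₁ N₂ θ₁ θ₂ a₁ a₂ k x) :
    a ≤ N₁ * N₂ * Real.exp ((θ₁ + θ₂) * Real.sqrt (x * (1 - x))) * a₁ ^ (1 - x) * a₂ ^ x := by
  rw [mul_assoc _ (a₁ ^ (1 - x))]
  refine le_mul_exp_sqrt_of_forall_le (by positivity) (by positivity) hθ
    (mul_nonneg hx.1 (sub_nonneg.2 hx.2)) fun k hk => (h k hk).trans_eq ?_
  simp only [interpBound, Complex.ofReal_re, Complex.ofReal_im]
  ring_nf

end Corollary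

end SectorialInterpolation

end

open SectorialInterpolation

theorem corollary4p8_general
    {H₁ H₂ : Type*}
    [NormedAddCommGroup H₁] [InnerProductSpace ℂ H₁] [CompleteSpace H₁]
    [NormedAddCommGroup H₂] [InnerProductSpace ℂ H₂] [CompleteSpace H₂]
    (T₁ : H₁ →ₗ.[ℂ] H₁) (T₂ : H₂ →ₗ.[ℂ] H₂) (S : H₁ →ₗ.[ℂ] H₂)
    (hT₁ : IsSectorial T₁) (hT₂ : IsSectorial T₂)
    (hT₁inv : (0 : ℂ) ∈ resSet T₁)
    (hT₂inv : (0 : ℂ) ∈ resSet T₂)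
    (N₁ N₂ θ₁ θ₂ : ℝ) (hBIP₁ : HasBIP T₁ N₁ θ₁) (hBIP₂ : HasBIP T₂ N₂ θ₂)
    (p : ℝ) (hp : 1 ≤ p)
    (A₁ : H₁ →L[ℂ] H₂) (hA₁ : opProd S T₁.inverse = ofBounded A₁)
    (hA₁p : MemSchatten p A₁)
    (A₂ : H₂ →L[ℂ] H₁) (hA₂ : opProd S† T₂†.inverse = ofBounded A₂)
    (hA₂p : MemSchatten p A₂) :
    ∃ B : ℂ → (H₁ →L[ℂ] H₂),
      (∀ z : ℂ, 0 ≤ z.re → z.re ≤ 1 →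
        T₁.domain ≤ (sandwich T₁ T₂ S z).domain ∧
        ((sandwich T₁ T₂ S z).domRestrict T₁.domain).IsClosable ∧
        ((sandwich T₁ T₂ S z).domRestrict T₁.domain).closure = ofBounded (B z) ∧
        MemSchatten p (B z) ∧
        ∀ k : ℝ, 0 < k →
          schattenNorm p (B z) ≤
            N₁ * N₂ * Real.exp (k * z.im ^ 2 + k * z.re * (1 - z.re)
                + (4 * k)⁻¹ * (θ₁ + θ₂) ^ 2)
              * schattenNorm p A₁ ^ (1 - z.re) * schattenNorm p A₂ ^ z.re) ∧
      (∀ x : ℝ, 0 ≤ x → x ≤ 1 →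
        schattenNorm p (B (x : ℂ)) ≤
          N₁ * N₂ * Real.exp ((θ₁ + θ₂) * Real.sqrt (x * (1 - x)))
            * schattenNorm p A₁ ^ (1 - x) * schattenNorm p A₂ ^ x) := by
  have hB_ex (z : ℂ) := exists_closure_sandwich_eq_ofBounded hT₁ hT₂ hT₁inv hT₂inv hBIP₁ hBIP₂ hp
    hA₁ hA₁p hA₂ hA₂p (z := z)
  choose! B hB using hB_ex
  refine ⟨B, fun z hz0 hz1 => ?_, fun x hx0 hx1 => ?_⟩
  · obtain ⟨⟨hle, hcl, heq⟩, hmem, hbound⟩ := hB z ⟨hz0, hz1⟩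
    exact ⟨hle, hcl, heq, hmem, hbound⟩
  · exact le_of_forall_le_interpBound (zero_le_one.trans hBIP₁.one_le)
      (zero_le_one.trans hBIP₂.one_le) (add_nonneg hBIP₁.nonneg hBIP₂.nonneg)
      (schattenNorm_nonneg p A₁) (schattenNorm_nonneg p A₂) ⟨hx0, hx1⟩ (hB x ⟨hx0, hx1⟩).2.2

theorem corollary4p8
    {H₁ H₂ : Type*}
    [NormedAddCommGroup H₁] [InnerProductSpace ℂ H₁] [CompleteSpace H₁]
    [TopologicalSpace.SeparableSpace H₁]
    [NormedAddCommGroup H₂] [InnerProductSpace ℂ H₂] [CompleteSpace H₂]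
    [TopologicalSpace.SeparableSpace H₂]
    (T₁ : H₁ →ₗ.[ℂ] H₁) (T₂ : H₂ →ₗ.[ℂ] H₂) (S : H₁ →ₗ.[ℂ] H₂)
    -- `T_j` is sectorial and `T_j⁻¹ ∈ B(H_j)`
    (hT₁ : IsSectorial T₁) (hT₂ : IsSectorial T₂)
    (hT₁inv : (0 : ℂ) ∈ resSet T₁)
    (hT₂inv : (0 : ℂ) ∈ resSet T₂)
    (hS : S.IsClosed)
    (hdom : T₁.domain ≤ S.domain) (hdom' : T₂†.domain ≤ S†.domain)
    (N₁ N₂ θ₁ θ₂ : ℝ) (hBIP₁ : HasBIP T₁ N₁ θ₁) (hBIP₂ : HasBIP T₂ N₂ θ₂)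
    (p : ℝ) (hp : 1 ≤ p)
    -- `A₁ = S T₁⁻¹ ∈ B_p(H₁, H₂)` and `A₂ = S* (T₂*)⁻¹ ∈ B_p(H₂, H₁)`
    (A₁ : H₁ →L[ℂ] H₂) (hA₁ : opProd S T₁.inverse = ofBounded A₁)
    (hA₁p : MemSchatten p A₁)
    (A₂ : H₂ →L[ℂ] H₁) (hA₂ : opProd S† T₂†.inverse = ofBounded A₂)
    (hA₂p : MemSchatten p A₂) :
    -- `B z` is the closure of `T₂^{-z} S T₁^{-1+z}` defined on `dom T₁`
    ∃ B : ℂ → (H₁ →L[ℂ] H₂),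
      (∀ z : ℂ, 0 ≤ z.re → z.re ≤ 1 →
        T₁.domain ≤ (sandwich T₁ T₂ S z).domain ∧
        ((sandwich T₁ T₂ S z).domRestrict T₁.domain).IsClosable ∧
        ((sandwich T₁ T₂ S z).domRestrict T₁.domain).closure = ofBounded (B z) ∧
        MemSchatten p (B z) ∧
        ∀ k : ℝ, 0 < k →
          schattenNorm p (B z) ≤
            N₁ * N₂ * Real.exp (k * z.im ^ 2 + k * z.re * (1 - z.re)
                + (4 * k)⁻¹ * (θ₁ + θ₂) ^ 2)
              * schattenNorm p A₁ ^ (1 - z.re) * schattenNorm p A₂ ^ z.re) ∧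
      (∀ x : ℝ, 0 ≤ x → x ≤ 1 →
        schattenNorm p (B (x : ℂ)) ≤
          N₁ * N₂ * Real.exp ((θ₁ + θ₂) * Real.sqrt (x * (1 - x)))
            * schattenNorm p A₁ ^ (1 - x) * schattenNorm p A₂ ^ x) := by
  exact corollary4p8_general T₁ T₂ S hT₁ hT₂ hT₁inv hT₂inv N₁ N₂ θ₁ θ₂ hBIP₁ hBIP₂ p hp
    A₁ hA₁ hA₁p A₂ hA₂ hA₂p
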